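/- Let $k$ be a totally real number field with ring of integers $\mathcal O_k$, let $\chi(x)\in\mathcal O_k[x]$ be an irreducible monic polynomial of degree $n$, and suppose that the field $K=k[x]/(\chi(x))$ is also totally real. Let $X$ be the $\mathcal O_k$-scheme of $n\times n$ matrices with characteristic polynomial $\chi$, fix $x_0\in X(\mathcal O_k)$, and let $\mathrm T_{x_0}\subset \mathrm{GL}_n$ be the centralizer of $x_0$. For an archimedean place $v$ of $k$ (so $k_v=\mathbb R$) the torus $\mathrm T_{x_0}$ splits over $k_v$ and $X(k_v)\cong \mathrm T_{x_0}(k_v)\backslash \mathrm{GL}_n(k_v)$ via $g\mapsto g^{-1}x_0g$. Let $d\mu_v$ be the measure on $X(k_v)$ which under this identification is the quotient of the Haar measure $|\det g|^{-n}\prod_{i,j}dg_{ij}$ of $\mathrm{GL}_n(k_v)$ by the Haar measure $\prod_{i=1}^n dt_i/|t_i|$ of $\mathrm T_{x_0}(k_v)\cong(\mathbb R^\times)^n$, where $t_1,\dots,t_n$ are the eigenvalues of $t\in \mathrm T_{x_0}(k_v)$ on the $n$ eigenlines of $x_0$. For $T>0$ put $$X(k_v,T)=\Big\{x\in X(k_v)\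 :\ \|x\|_v=\Big(\sum_{i,j=1}^n|x_{ij}|_v^2\Big)^{1/2}\le T\Big\}.$$ Then every $\mathrm{vol}(d\mu_v,X(k_v,T))$ is finite and, as $T\to\infty$, $$\prod_{v\mid\infty}\mathrm{vol}(d\mu_v,X(k_v,T))\ \sim\ \left(\frac{w_n\,\pi^{n(n+1)/4}}{\prod_{i=1}^n\Gamma(i/2)}\;T^{\,n(n-1)/2}\right)^{[k:\mathbb Q]}\prod_{v\mid\infty}|\Delta_\chi|_v^{-1/2},$$ meaning that the quotient of the two sides tends to $1$. Here the products run over the archimedean places $v$ of $k$, $w_n$ is the volume of the unit ball in $\mathbb R^{n(n-1)/2}$ (with $w_1=1$), and $\Delta_\chi$ is the discriminant of $\chi$. -/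

import Mathlib

open MeasureTheory Polynomial NumberField Filter Topology
open scoped ENNReal Matrix MatrixGroups

namespace ArchVolume

/-- The `R`-points of the scheme of `n × n` matrices with characteristic polynomial `p`. -/
abbrev CharpolyFiber {R : Type*} [CommRing R] (n : ℕ) (p : R[X]) : Type _ :=
  {x : Matrix (Fin n) (Fin n) R // x.charpoly = p}

/-- The map on points of the scheme induced by a ring homomorphism `f : R → S`, applied entrywise. -/
def CharpolyFiber.baseChange {R S : Type*} [CommRing R] [CommRing S] {n : ℕ} {p : R[X]}
    (f : R →+* S) (x : CharpolyFiber n p) : CharpolyFiber n (p.map f) :=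
  ⟨x.1.map f, by rw [Matrix.charpoly_map, x.2]⟩

/-- The orbit map `g ↦ g⁻¹ x₀ g` from `GL_n` to the matrices with the same characteristic
polynomial as `x₀`. -/
def CharpolyFiber.orbit {R : Type*} [CommRing R] {n : ℕ} {p : R[X]}
    (x₀ : CharpolyFiber n p) (g : GL (Fin n) R) : CharpolyFiber n p :=
  ⟨(g⁻¹ : GL (Fin n) R).1 * x₀.1 * g.1, by
    rw [Matrix.charpoly_mul_comm, ← mul_assoc, Units.mul_inv, one_mul, x₀.2]⟩

/-- Lebesgue measure `∏ dx_ij` on real square matrices, together with the Borel sets. -/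
noncomputable instance matrixMeasureSpace (n : ℕ) : MeasureSpace (Matrix (Fin n) (Fin n) ℝ) :=
  inferInstanceAs (MeasureSpace (Fin n → Fin n → ℝ))

/-- The measure `|det A|⁻ⁿ ∏ dA_ij` on real square matrices. -/
noncomputable def matrixHaar (n : ℕ) : Measure (Matrix (Fin n) (Fin n) ℝ) :=
  volume.withDensity fun A => ENNReal.ofReal (|A.det| ^ n)⁻¹

/-- The Haar measure on `GL_n(ℝ)` attached to the canonical invariant form
`ω = det(g)⁻ⁿ ⋀ dg_ij`. -/
noncomputable def glHaar (n : ℕ) : Measure (GL (Fin n) ℝ) :=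
  (matrixHaar n).comap Units.val

/-- The measure `dt / |t|` on `ℝ` (that is, the canonical Haar measure of `ℝˣ`, extended by
zero). -/
noncomputable def multHaar : Measure ℝ :=
  volume.withDensity fun t => ENNReal.ofReal |t|⁻¹

/-- For a matrix `x` whose characteristic polynomial has only simple roots, all of them real, the
projector onto the eigenspace of the root `r`, as a polynomial in `x`. -/
noncomputable def CharpolyFiber.eigenProj {n : ℕ} {p : ℝ[X]} (x : CharpolyFiber n p)
    (r : p.roots.toFinset) : Matrix (Fin n) (Fin n) ℝ :=
  aeval x.1 (Lagrange.basis p.roots.toFinset id r.1)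

/-- The element of `ℝ[x]` acting on the eigenspace of `r` by the scalar `t r`. If the
characteristic polynomial has only simple roots, all of them real, then
`t ↦ x.torusParam t`, for `t` with nonzero coordinates, is the isomorphism of the split torus
`(ℝˣ)^roots` with the centralizer `T_x(ℝ) = ℝ[x]ˣ` of `x` in `GL_n(ℝ)`. -/
noncomputable def CharpolyFiber.torusParam {n : ℕ} {p : ℝ[X]} (x : CharpolyFiber n p)
    (t : p.roots.toFinset → ℝ) : Matrix (Fin n) (Fin n) ℝ :=
  ∑ r, t r • x.eigenProj r

/-- The Haar measure on the split torus `T_x(ℝ)` attached to the canonical invariant form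
`⋀ dt_r / t_r`, where the characters `t_r` (the eigenvalues) are a basis of the character group.
It is regarded as a measure on `GL_n(ℝ)` supported on the centralizer of `x`. -/
noncomputable def CharpolyFiber.torusHaar {n : ℕ} {p : ℝ[X]} (x : CharpolyFiber n p) :
    Measure (GL (Fin n) ℝ) :=
  ((Measure.pi fun _ : p.roots.toFinset => multHaar).map x.torusParam).comap Units.val

/-- `μ` is the quotient of the canonical measure of `GL_n(ℝ)` by that of `T_{x₀}(ℝ)`:
identifying the fibre with `T_{x₀}(ℝ) \ GL_n(ℝ)` by `g ↦ g⁻¹ x₀ g`,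
`∫_{GL_n} f(g) dg = ∫_{T \ GL_n} (∫_T f(t g) dt) dμ(g)` for all measurable `f ≥ 0`. The inner
integral, a function of the coset of `g`, is the function called `F`. -/
def CharpolyFiber.IsQuotientMeasure {n : ℕ} {p : ℝ[X]} (x₀ : CharpolyFiber n p)
    (μ : Measure (CharpolyFiber n p)) : Prop :=
  ∀ (f : GL (Fin n) ℝ → ℝ≥0∞) (F : CharpolyFiber n p → ℝ≥0∞), Measurable f → Measurable F →
    (∀ g, F (x₀.orbit g) = ∫⁻ t, f (t * g) ∂x₀.torusHaar) →
    ∫⁻ g, f g ∂glHaar n = ∫⁻ x, F x ∂μ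

/-! ### Existence and uniqueness of the quotient measure

The results of this section are proved here only to show that the quotient measure is well
defined; the final one is `existsUnique_isQuotientMeasure`. -/

section QuotientMeasure

variable {n : ℕ} {p : ℝ[X]}

theorem aeval_congr (x : CharpolyFiber n p) (hs : p.Splits) (hn : p.roots.Nodup)
    (f g : ℝ[X]) (h : ∀ r ∈ p.roots, f.eval r = g.eval r) : aeval x.1 f = aeval x.1 g := by
  have hm : p.Monic := x.2 ▸ Matrix.charpoly_monic x.1
  have hd : p ∣ f - g := by
    have hp : p = ∏ r ∈ p.roots.toFinset, (X - C r) := by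
      conv_lhs => rw [hs.eq_prod_roots_of_monic hm]
      rw [Finset.prod_eq_multiset_prod, Multiset.toFinset_val, hn.dedup]
    rw [hp]
    refine Finset.prod_dvd_of_coprime
      (fun a _ b _ hab => pairwise_coprime_X_sub_C Function.injective_id hab) fun r hr => ?_
    rw [dvd_iff_isRoot, IsRoot, eval_sub, h r (by simpa using hr), sub_self]
  obtain ⟨q, hq⟩ := hd
  have h0 : aeval x.1 p = 0 := by
    have := Matrix.aeval_self_charpoly x.1
    rwa [x.2] at this
  have : aeval x.1 (f - g) = 0 := by rw [hq, map_mul, h0, zero_mul]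
  rwa [map_sub, sub_eq_zero] at this

/-- The polynomial taking the value `t r` at each root `r` of `p`. -/
noncomputable def interp (p : ℝ[X]) (t : p.roots.toFinset → ℝ) : ℝ[X] :=
  ∑ r, t r • Lagrange.basis p.roots.toFinset id r.1

theorem torusParam_eq (x : CharpolyFiber n p) (t : p.roots.toFinset → ℝ) :
    x.torusParam t = aeval x.1 (interp p t) := by
  simp [CharpolyFiber.torusParam, interp, CharpolyFiber.eigenProj]

theorem basis_eval (p : ℝ[X]) (r s : p.roots.toFinset) :
    (Lagrange.basis p.roots.toFinset id r.1).eval s.1 = if r = s then 1 else 0 := by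
  split_ifs with h
  · subst h
    exact Lagrange.eval_basis_self (v := id) (Function.injective_id.injOn) r.2
  · exact Lagrange.eval_basis_of_ne (v := id) (fun hh => h (Subtype.ext hh)) s.2

theorem interp_eval (t : p.roots.toFinset → ℝ) (s : p.roots.toFinset) :
    (interp p t).eval s.1 = t s := by
  simp [interp, eval_finsetSum, basis_eval]

theorem torusParam_mul (x : CharpolyFiber n p) (hs : p.Splits) (hn : p.roots.Nodup)
    (t u : p.roots.toFinset → ℝ) : x.torusParam t * x.torusParam u = x.torusParam (t * u) := by
  simp only [torusParam_eq, ← map_mul]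
  refine aeval_congr x hs hn _ _ fun r hr => ?_
  have := fun t => interp_eval (p := p) t ⟨r, by simpa using hr⟩
  simp only at this
  simp [this]

theorem torusParam_one (x : CharpolyFiber n p) (hs : p.Splits) (hn : p.roots.Nodup) :
    x.torusParam 1 = 1 := by
  rw [torusParam_eq, ← map_one (aeval (R := ℝ) x.1)]
  refine aeval_congr x hs hn _ _ fun r hr => ?_
  have := fun t => interp_eval (p := p) t ⟨r, by simpa using hr⟩
  simp only at this
  simp [this]

theorem eigenProj_mul_torusParam (x : CharpolyFiber n p) (hs : p.Splits) (hn : p.roots.Nodup)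
    (t : p.roots.toFinset → ℝ) (s : p.roots.toFinset) :
    x.eigenProj s * x.torusParam t = t s • x.eigenProj s := by
  simp only [torusParam_eq, CharpolyFiber.eigenProj, ← map_mul, ← map_smul]
  refine aeval_congr x hs hn _ _ fun r hr => ?_
  have h1 := interp_eval (p := p) t ⟨r, by simpa using hr⟩
  have h2 := basis_eval p s ⟨r, by simpa using hr⟩
  simp only at h1 h2
  simp only [eval_mul, h1, h2, eval_smul, smul_eq_mul]
  split_ifs with h
  · rw [h]; ring
  · ring

theorem eigenProj_ne_zero (x : CharpolyFiber n p) (s : p.roots.toFinset) :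
    x.eigenProj s ≠ 0 := by
  intro h0
  have hr : x.1.charpoly.IsRoot s.1 := by
    rw [x.2]
    have := s.2
    simp only [Multiset.mem_toFinset] at this
    exact isRoot_of_mem_roots this
  have h1 : Module.End.HasEigenvalue (Matrix.toLin' x.1) s.1 := by
    rw [Module.End.hasEigenvalue_iff_isRoot_charpoly, Matrix.charpoly_toLin']
    exact hr
  obtain ⟨v, hv⟩ := h1.exists_hasEigenvector
  have h2 := Module.End.aeval_apply_of_hasEigenvector (p := Lagrange.basis p.roots.toFinset id s.1) hv
  rw [basis_eval p s s, if_pos rfl, one_smul] at h2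
  have h3 : aeval (Matrix.toLin' x.1) (Lagrange.basis p.roots.toFinset id s.1)
     = Matrix.toLinAlgEquiv' (x.eigenProj s) := by
    rw [CharpolyFiber.eigenProj, ← aeval_algHom_apply]
    rfl
  rw [h3, h0] at h2
  simp at h2
  exact hv.2 h2.symm

theorem torusParam_comm (x : CharpolyFiber n p) (t : p.roots.toFinset → ℝ) :
    x.torusParam t * x.1 = x.1 * x.torusParam t := by
  rw [torusParam_eq]
  have h := congrArg (aeval (R := ℝ) x.1) (mul_comm (interp p t) X)
  simpa only [map_mul, aeval_X] using h

instance : BorelSpace (Matrix (Fin n) (Fin n) ℝ) := inferInstanceAs (BorelSpace (Fin n → Fin n → ℝ))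
instance : SigmaFinite (volume : Measure (Matrix (Fin n) (Fin n) ℝ)) := inferInstanceAs (SigmaFinite (volume : Measure (Fin n → Fin n → ℝ)))
instance : SecondCountableTopology (Matrix (Fin n) (Fin n) ℝ) := inferInstanceAs (SecondCountableTopology (Fin n → Fin n → ℝ))
instance : SigmaFinite (matrixHaar n) := by unfold matrixHaar; infer_instance
instance : SigmaFinite multHaar := by unfold multHaar; infer_instance

theorem measurableEmbedding_val :
    MeasurableEmbedding (Units.val : GL (Fin n) ℝ → Matrix (Fin n) (Fin n) ℝ) where
  injective := Units.val_injective
  measurable := Measurable.of_comap_le le_rfl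
  measurableSet_image' := by
    rintro s ⟨t, ht, rfl⟩
    have : (Units.val '' (Units.val ⁻¹' t) : Set (Matrix (Fin n) (Fin n) ℝ)) = t ∩ {A | A.det ≠ 0} := by
      rw [Set.image_preimage_eq_inter_range]
      congr 1
      ext A
      simp only [Set.mem_range, Set.mem_ofPred_eq, ← isUnit_iff_ne_zero, ← Matrix.isUnit_iff_isUnit_det]
      rfl
    rw [this]
    refine ht.inter ?_
    have : Continuous (fun A : Matrix (Fin n) (Fin n) ℝ => A.det) := continuous_id.matrix_det
    exact (isOpen_ne_fun this continuous_const).measurableSet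

theorem measurable_mat_mul : Measurable fun q : Matrix (Fin n) (Fin n) ℝ × Matrix (Fin n) (Fin n) ℝ => q.1 * q.2 :=
  (continuous_fst.matrix_mul continuous_snd).measurable

theorem measurable_det : Measurable fun A : Matrix (Fin n) (Fin n) ℝ => A.det :=
  (continuous_id.matrix_det).measurable

theorem lmul_volume (u : GL (Fin n) ℝ) (f : Matrix (Fin n) (Fin n) ℝ → ℝ≥0∞) (hf : Measurable f) :
    ∫⁻ A, f (u.1 * A) = ENNReal.ofReal (|u.1.det| ^ n)⁻¹ * ∫⁻ A, f A := by
  let L : (Fin n → Fin n → ℝ) →ₗ[ℝ] (Fin n → Fin n → ℝ) := LinearMap.mulLeft ℝ (A := Matrix (Fin n) (Fin n) ℝ) u.1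
  let e : (Fin n → Fin n → ℝ) ≃ₗ[ℝ] (Fin n → Fin n → ℝ) := Matrix.transposeLinearEquiv (Fin n) (Fin n) ℝ ℝ
  have hdet : LinearMap.det L = u.1.det ^ n := by
    rw [← LinearMap.det_conj L e]
    have : (e : (Fin n → Fin n → ℝ) →ₗ[ℝ] (Fin n → Fin n → ℝ)) ∘ₗ L ∘ₗ
        (e.symm : (Fin n → Fin n → ℝ) →ₗ[ℝ] (Fin n → Fin n → ℝ)) =
      LinearMap.pi fun i => (Matrix.toLin' u.1) ∘ₗ LinearMap.proj i := by
      refine LinearMap.ext fun A => ?_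
      rfl
    rw [this, LinearMap.det_pi]
    simp
  have h0 : LinearMap.det L ≠ 0 := by
    rw [hdet]
    exact pow_ne_zero _ ((Matrix.isUnit_iff_isUnit_det _).1 u.isUnit).ne_zero
  have hm := Measure.map_linearMap_addHaar_eq_smul_addHaar (μ := (volume : Measure (Fin n → Fin n → ℝ))) h0
  have hL : Measurable L := (LinearMap.continuous_of_finiteDimensional L).measurable
  let f' : (Fin n → Fin n → ℝ) → ℝ≥0∞ := f
  have hf' : Measurable f' := hf
  have : ∫⁻ a, f' a ∂(Measure.map L (volume : Measure (Fin n → Fin n → ℝ))) =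
    ∫⁻ a : Fin n → Fin n → ℝ, f' (L a) := lintegral_map hf' hL
  rw [hm, lintegral_smul_measure, hdet] at this
  rw [← abs_pow, ← abs_inv]
  exact this.symm

theorem lmul_matrixHaar (u : GL (Fin n) ℝ) (f : Matrix (Fin n) (Fin n) ℝ → ℝ≥0∞) (hf : Measurable f) :
    ∫⁻ A, f (u.1 * A) ∂matrixHaar n = ∫⁻ A, f A ∂matrixHaar n := by
  set d : Matrix (Fin n) (Fin n) ℝ → ℝ≥0∞ := fun A => ENNReal.ofReal (|A.det| ^ n)⁻¹ with hd'
  have hd : Measurable d := by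
    have := measurable_det (n := n)
    fun_prop
  have hu : |u.1.det| ^ n ≠ 0 := pow_ne_zero _
    (abs_ne_zero.2 ((Matrix.isUnit_iff_isUnit_det _).1 u.isUnit).ne_zero)
  have hl : Measurable fun A : Matrix (Fin n) (Fin n) ℝ => u.1 * A :=
    measurable_mat_mul.comp (measurable_const.prodMk measurable_id)
  set g : Matrix (Fin n) (Fin n) ℝ → ℝ≥0∞ := fun A => f (u.1 * A) with hg
  have hfl : Measurable g := hf.comp hl
  have e1 := lintegral_withDensity_eq_lintegral_mul volume hd hfl
  have e2 := lintegral_withDensity_eq_lintegral_mul volume hd hf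
  have key : ∀ A : Matrix (Fin n) (Fin n) ℝ, (d * g) A
      = ENNReal.ofReal (|u.1.det| ^ n) * (d * f) (u.1 * A) := by
    intro A
    simp only [Pi.mul_apply, ← mul_assoc, hd', hg]
    congr 1
    rw [← ENNReal.ofReal_mul (by positivity), Matrix.det_mul, abs_mul, mul_pow, mul_inv,
      mul_inv_cancel_left₀ hu]
  have hdl : Measurable fun A => (d * f) (u.1 * A) := (hd.mul hf).comp hl
  unfold matrixHaar
  rw [e1, e2, lintegral_congr key, lintegral_const_mul _ hdl, lmul_volume u _ (hd.mul hf),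
    ← mul_assoc, ← ENNReal.ofReal_mul (by positivity), mul_inv_cancel₀ hu]
  simp

theorem multHaar_Ioc {a b : ℝ} (ha : 0 < a) (hab : a ≤ b) :
    multHaar (Set.Ioc a b) = ENNReal.ofReal (Real.log (b / a)) := by
  have hb : 0 < b := ha.trans_le hab
  rw [multHaar, withDensity_apply _ measurableSet_Ioc, ← integral_inv_of_pos ha hb,
    intervalIntegral.integral_of_le hab, ofReal_integral_eq_lintegral_ofReal]
  · refine setLIntegral_congr_fun measurableSet_Ioc fun t ht => ?_
    simp only [abs_of_pos (ha.trans ht.1)]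
  · change IntegrableOn (fun t : ℝ => t⁻¹) (Set.Ioc a b) volume
    rw [← intervalIntegrable_iff_integrableOn_Ioc_of_le hab]
    refine intervalIntegral.intervalIntegrable_inv (fun t ht => ?_) continuousOn_id
    rw [Set.uIcc_of_le hab] at ht
    exact (ha.trans_le ht.1).ne'
  · filter_upwards [ae_restrict_mem measurableSet_Ioc] with t ht
    exact inv_nonneg.2 (ha.trans ht.1).le

instance : NullSingletonClass multHaar :=
  ⟨fun x => withDensity_absolutelyContinuous _ _ (measure_singleton x)⟩

theorem multHaar_neg (s : Set ℝ) (hs : MeasurableSet s) : multHaar (-s) = multHaar s := by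
  rw [multHaar, withDensity_apply _ hs, withDensity_apply _ hs.neg]
  have := (Measure.measurePreserving_neg (volume : Measure ℝ)).setLIntegral_comp_preimage hs
    (f := fun t => ENNReal.ofReal |t|⁻¹) (by fun_prop)
  simpa using this

theorem multHaar_annulus {a b : ℝ} (ha : 0 < a) (hab : a ≤ b) :
    multHaar {t | a < |t| ∧ |t| ≤ b} = 2 * ENNReal.ofReal (Real.log (b / a)) := by
  have h : {t | a < |t| ∧ |t| ≤ b} = Set.Ioc a b ∪ -Set.Ioc a b := by
    ext t
    simp only [Set.mem_ofPred_eq, Set.mem_union, Set.mem_Ioc, Set.mem_neg]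
    rcases abs_cases t with ⟨h1, h2⟩ | ⟨h1, h2⟩ <;> rw [h1]
    · exact ⟨Or.inl, fun h => h.elim id fun h => by linarith [h.1]⟩
    · exact ⟨Or.inr, fun h => h.elim (fun h => by linarith [h.1]) id⟩
  have hd : Disjoint (Set.Ioc a b) (-Set.Ioc a b) := by
    rw [Set.disjoint_left]
    intro t h1 h2
    simp only [Set.mem_Ioc, Set.mem_neg] at h1 h2
    linarith [h1.1, h2.1]
  rw [h, measure_union hd measurableSet_Ioc.neg, multHaar_neg _ measurableSet_Ioc,
    multHaar_Ioc ha hab, two_mul]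

theorem multHaar_annulus' {a b : ℝ} (ha : 0 < a) (hab : a ≤ b) :
    multHaar {t | a ≤ |t| ∧ |t| < b} = 2 * ENNReal.ofReal (Real.log (b / a)) := by
  rw [← multHaar_annulus ha hab]
  refine measure_congr ?_
  have : ∀ᵐ t ∂multHaar, t ∉ ({a, -a, b, -b} : Set ℝ) :=
    measure_eq_zero_iff_ae_notMem.1 ((Set.toFinite _).measure_zero _)
  filter_upwards [this] with t ht
  simp only [Set.mem_insert_iff, Set.mem_singleton_iff, not_or] at ht
  obtain ⟨h1, h2, h3, h4⟩ := ht
  have ha' : |t| ≠ a := fun h => by rcases abs_eq ha.le |>.1 h with h | h <;> contradiction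
  have hb' : |t| ≠ b := fun h => by
    rcases abs_eq (ha.le.trans hab) |>.1 h with h | h <;> contradiction
  refine propext ⟨fun h => ⟨lt_of_le_of_ne h.1 ha'.symm, h.2.le⟩,
    fun h => ⟨h.1.le, lt_of_le_of_ne h.2 hb'⟩⟩

/-- The volume of an annulus `1 ≤ |t| < 2` for `dt/|t|`. -/
noncomputable def annC : ℝ≥0∞ := 2 * ENNReal.ofReal (Real.log 2)

theorem annC_ne_zero : annC ≠ 0 := by
  simp [annC, Real.log_pos]
theorem annC_ne_top : annC ≠ ∞ := by
  simp [annC, ENNReal.mul_eq_top]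

theorem multHaar_ann1 {ρ : ℝ} (h : 0 < ρ) : multHaar {t | 1 ≤ |t| * ρ ∧ |t| * ρ < 2} = annC := by
  have : {t : ℝ | 1 ≤ |t| * ρ ∧ |t| * ρ < 2} = {t | ρ⁻¹ ≤ |t| ∧ |t| < 2 * ρ⁻¹} := by
    ext t
    simp only [Set.mem_ofPred_eq, ← div_eq_mul_inv, lt_div_iff₀ h, inv_le_iff_one_le_mul₀ h]
  have h' : 0 < ρ⁻¹ := inv_pos.2 h
  rw [this, multHaar_annulus' h' (by linarith), mul_div_assoc, div_self h'.ne', mul_one, annC]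

theorem multHaar_ann2 {ρ : ℝ} (h : 0 < ρ) :
    multHaar {t | 1 ≤ |t|⁻¹ * ρ ∧ |t|⁻¹ * ρ < 2} = annC := by
  have : {t : ℝ | 1 ≤ |t|⁻¹ * ρ ∧ |t|⁻¹ * ρ < 2} = {t | ρ / 2 < |t| ∧ |t| ≤ ρ} := by
    ext t
    simp only [Set.mem_ofPred_eq]
    rcases eq_or_ne t 0 with rfl | ht
    · simp only [abs_zero, inv_zero, zero_mul]
      exact ⟨fun h' => by linarith [h'.1], fun h' => by linarith [h'.1]⟩
    · have ht' := abs_pos.2 ht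
      rw [inv_mul_eq_div, le_div_iff₀ ht', div_lt_iff₀ ht', one_mul, and_comm, div_lt_iff₀ two_pos,
        mul_comm]
  rw [this, multHaar_annulus (by linarith) (by linarith), annC]
  congr 3
  field_simp

/-- The sum of the absolute values of the entries. -/
def entryNorm (A : Matrix (Fin n) (Fin n) ℝ) : ℝ := ∑ i, ∑ j, |A i j|

theorem entryNorm_smul (c : ℝ) (A : Matrix (Fin n) (Fin n) ℝ) :
    entryNorm (c • A) = |c| * entryNorm A := by
  simp [entryNorm, abs_mul, Finset.mul_sum]

theorem entryNorm_pos {A : Matrix (Fin n) (Fin n) ℝ} (h : A ≠ 0) : 0 < entryNorm A := by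
  by_contra hc
  apply h
  have h0 : entryNorm A = 0 := le_antisymm (not_lt.1 hc)
    (Finset.sum_nonneg fun _ _ => Finset.sum_nonneg fun _ _ => abs_nonneg _)
  rw [entryNorm, Finset.sum_eq_zero_iff_of_nonneg
    (fun _ _ => Finset.sum_nonneg fun _ _ => abs_nonneg _)] at h0
  ext i j
  have := h0 i (Finset.mem_univ _)
  rw [Finset.sum_eq_zero_iff_of_nonneg (fun _ _ => abs_nonneg _)] at this
  simpa using this j (Finset.mem_univ _)

theorem continuous_entryNorm : Continuous (entryNorm : Matrix (Fin n) (Fin n) ℝ → ℝ) := by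
  unfold entryNorm
  fun_prop

/-- A measurable set meeting every torus coset in a set of the same finite positive volume. -/
def wset (x : CharpolyFiber n p) : Set (Matrix (Fin n) (Fin n) ℝ) :=
  {A | ∀ r, 1 ≤ entryNorm (x.eigenProj r * A) ∧ entryNorm (x.eigenProj r * A) < 2}

theorem measurable_nr (x : CharpolyFiber n p) (r) :
    Measurable fun A : Matrix (Fin n) (Fin n) ℝ => entryNorm (x.eigenProj r * A) :=
  (continuous_entryNorm.comp (continuous_const.matrix_mul continuous_id)).measurable

theorem measurableSet_wset (x : CharpolyFiber n p) : MeasurableSet (wset x) := by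
  unfold wset
  simp only [Set.ofPred_forall]
  refine MeasurableSet.iInter fun r => ?_
  have := measurable_nr x r
  exact (measurableSet_le measurable_const this).inter (measurableSet_lt this measurable_const)

theorem continuous_torusParam (x : CharpolyFiber n p) : Continuous x.torusParam := by
  unfold CharpolyFiber.torusParam
  fun_prop

/-- Extension by zero from `GL_n(ℝ)` to all matrices. -/
noncomputable def ext0 (f : GL (Fin n) ℝ → ℝ≥0∞) : Matrix (Fin n) (Fin n) ℝ → ℝ≥0∞ :=
  Function.extend Units.val f 0

theorem ext0_val (f : GL (Fin n) ℝ → ℝ≥0∞) (g : GL (Fin n) ℝ) : ext0 f g.1 = f g :=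
  Units.val_injective.extend_apply _ _ _

theorem ext0_not (f : GL (Fin n) ℝ → ℝ≥0∞) {A : Matrix (Fin n) (Fin n) ℝ} (h : ¬ IsUnit A) :
    ext0 f A = 0 := Function.extend_apply' _ _ _ (by rintro ⟨u, rfl⟩; exact h u.isUnit)

theorem measurable_ext0 {f : GL (Fin n) ℝ → ℝ≥0∞} (hf : Measurable f) : Measurable (ext0 f) :=
  measurableEmbedding_val.measurable_extend hf measurable_zero

theorem lintegral_comap_val (m : Measure (Matrix (Fin n) (Fin n) ℝ)) {f : GL (Fin n) ℝ → ℝ≥0∞} :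
    ∫⁻ g, f g ∂(m.comap Units.val) = ∫⁻ A, ext0 f A ∂m := by
  calc ∫⁻ g, f g ∂(m.comap Units.val) = ∫⁻ g, ext0 f g.1 ∂(m.comap Units.val) := by
        simp only [ext0_val]
    _ = ∫⁻ A, ext0 f A ∂(m.restrict (Set.range Units.val)) := by
        rw [← measurableEmbedding_val.map_comap, measurableEmbedding_val.lintegral_map]
    _ = ∫⁻ A, ext0 f A ∂m := by
        rw [← lintegral_indicator measurableEmbedding_val.measurableSet_range]
        refine lintegral_congr fun A => ?_
        by_cases h : A ∈ Set.range (Units.val : GL (Fin n) ℝ → _)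
        · rw [Set.indicator_of_mem h]
        · rw [Set.indicator_of_notMem h]
          exact (ext0_not f fun ⟨u, hu⟩ => h ⟨u, hu⟩).symm

theorem ext0_mul (f : GL (Fin n) ℝ → ℝ≥0∞) (g : GL (Fin n) ℝ) (A : Matrix (Fin n) (Fin n) ℝ) :
    ext0 (fun t => f (t * g)) A = ext0 f (A * g.1) := by
  by_cases h : IsUnit A
  · obtain ⟨u, rfl⟩ := h
    rw [ext0_val, ← Units.val_mul, ext0_val]
  · rw [ext0_not _ h, ext0_not]
    rwa [Units.isUnit_mul_units]

theorem torus_lintegral (x : CharpolyFiber n p) {f : GL (Fin n) ℝ → ℝ≥0∞} (hf : Measurable f)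
    (g : GL (Fin n) ℝ) : ∫⁻ t, f (t * g) ∂x.torusHaar =
      ∫⁻ t, ext0 f (x.torusParam t * g.1) ∂(Measure.pi fun _ : p.roots.toFinset => multHaar) := by
  rw [CharpolyFiber.torusHaar, lintegral_comap_val]
  simp only [ext0_mul]
  rw [lintegral_map _ (continuous_torusParam x).measurable]
  exact (measurable_ext0 hf).comp (measurable_mat_mul.comp (measurable_id.prodMk measurable_const))

theorem ae_ne_zero (p : ℝ[X]) :
    ∀ᵐ t ∂(Measure.pi fun _ : p.roots.toFinset => multHaar), ∀ r, t r ≠ 0 := by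
  rw [ae_all_iff]
  intro r
  have h : ∀ᵐ s ∂multHaar, s ≠ 0 := by
    simp [ae_iff, measure_singleton]
  exact (Measure.quasiMeasurePreserving_eval (fun _ : p.roots.toFinset => multHaar) r).ae h

/-- The unit attached to nonvanishing parameters. -/
noncomputable def torusUnit (x : CharpolyFiber n p) (hs : p.Splits) (hn : p.roots.Nodup)
    (t : p.roots.toFinset → ℝ) (ht : ∀ r, t r ≠ 0) : GL (Fin n) ℝ where
  val := x.torusParam t
  inv := x.torusParam t⁻¹
  val_inv := by
    rw [torusParam_mul x hs hn, ← torusParam_one x hs hn]; congr 1; ext r; simp [ht r]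
  inv_val := by
    rw [torusParam_mul x hs hn, ← torusParam_one x hs hn]; congr 1; ext r; simp [ht r]

theorem orbit_torusUnit (x : CharpolyFiber n p) (u g : GL (Fin n) ℝ) (hu : u.1 * x.1 = x.1 * u.1) :
    x.orbit (u * g) = x.orbit g := by
  apply Subtype.ext
  simp only [CharpolyFiber.orbit, mul_inv_rev, Units.val_mul]
  have : u⁻¹.1 * x.1 * u.1 = x.1 := by rw [mul_assoc, ← hu, ← mul_assoc, Units.inv_mul, one_mul]
  calc _ = g⁻¹.1 * (u⁻¹.1 * x.1 * u.1) * g.1 := by simp only [mul_assoc]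
    _ = _ := by rw [this]

theorem measurable_orbit (x : CharpolyFiber n p) : Measurable x.orbit := by
  refine Measurable.subtype_mk ?_
  have h1 : Measurable (Units.val : GL (Fin n) ℝ → Matrix (Fin n) (Fin n) ℝ) :=
    measurableEmbedding_val.measurable
  have h2 : Measurable fun g : GL (Fin n) ℝ => g⁻¹.1 := by
    have : ∀ g : GL (Fin n) ℝ, g⁻¹.1 = (g.1.det)⁻¹ • g.1.adjugate := by
      intro g
      rw [Matrix.coe_units_inv, Matrix.inv_def, Ring.inverse_eq_inv']
    simp only [this]
    have ha : Measurable fun A : Matrix (Fin n) (Fin n) ℝ => (A.det)⁻¹ • A.adjugate :=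
      measurable_det.inv.smul (continuous_id.matrix_adjugate.measurable)
    exact ha.comp h1
  exact measurable_mat_mul.comp ((measurable_mat_mul.comp (h2.prodMk measurable_const)).prodMk h1)

theorem nr_torus (x : CharpolyFiber n p) (hs : p.Splits) (hn : p.roots.Nodup)
    (t : p.roots.toFinset → ℝ) (r) (A : Matrix (Fin n) (Fin n) ℝ) :
    entryNorm (x.eigenProj r * (x.torusParam t * A)) = |t r| * entryNorm (x.eigenProj r * A) := by
  rw [← mul_assoc, eigenProj_mul_torusParam x hs hn, Matrix.smul_mul, entryNorm_smul]

theorem nr_pos (x : CharpolyFiber n p) (r) (g : GL (Fin n) ℝ) :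
    0 < entryNorm (x.eigenProj r * g.1) := by
  refine entryNorm_pos fun h => eigenProj_ne_zero x r ?_
  rw [← mul_one (x.eigenProj r), ← Units.mul_inv g, ← mul_assoc, h, zero_mul]

/-- The volume of the parameters `t` for which a translate `t g` lies in the weight set. -/
noncomputable def totC (p : ℝ[X]) : ℝ≥0∞ := ∏ _r : p.roots.toFinset, annC

theorem totC_ne_zero : totC p ≠ 0 := Finset.prod_ne_zero_iff.2 fun _ _ => annC_ne_zero
theorem totC_ne_top : totC p ≠ ∞ := ENNReal.prod_ne_top fun _ _ => annC_ne_top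

theorem pi_wset1 (x : CharpolyFiber n p) (hs : p.Splits) (hn : p.roots.Nodup) (g : GL (Fin n) ℝ) :
    Measure.pi (fun _ : p.roots.toFinset => multHaar) {t | x.torusParam t * g.1 ∈ wset x}
      = totC p := by
  have : {t | x.torusParam t * g.1 ∈ wset x} = Set.univ.pi fun r => {s | 1 ≤ |s| *
      entryNorm (x.eigenProj r * g.1) ∧ |s| * entryNorm (x.eigenProj r * g.1) < 2} := by
    ext t
    simp [wset, nr_torus x hs hn]
  rw [this, Measure.pi_pi]
  exact Finset.prod_congr rfl fun r _ => multHaar_ann1 (nr_pos x r g)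

theorem pi_wset2 (x : CharpolyFiber n p) (hs : p.Splits) (hn : p.roots.Nodup) (g : GL (Fin n) ℝ) :
    Measure.pi (fun _ : p.roots.toFinset => multHaar) {t | x.torusParam t⁻¹ * g.1 ∈ wset x}
      = totC p := by
  have : {t | x.torusParam t⁻¹ * g.1 ∈ wset x} = Set.univ.pi fun r => {s | 1 ≤ |s|⁻¹ *
      entryNorm (x.eigenProj r * g.1) ∧ |s|⁻¹ * entryNorm (x.eigenProj r * g.1) < 2} := by
    ext t
    simp [wset, nr_torus x hs hn, abs_inv]
  rw [this, Measure.pi_pi]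
  exact Finset.prod_congr rfl fun r _ => multHaar_ann2 (nr_pos x r g)

theorem IsQuotientMeasure.apply (x : CharpolyFiber n p) (hs : p.Splits) (hn : p.roots.Nodup)
    {μ : Measure (CharpolyFiber n p)} (h : x.IsQuotientMeasure μ) {B : Set (CharpolyFiber n p)}
    (hB : MeasurableSet B) :
    totC p * μ B = glHaar n ((Units.val ⁻¹' wset x) ∩ x.orbit ⁻¹' B) := by
  have hval := (measurableEmbedding_val (n := n)).measurable
  have hS : MeasurableSet ((Units.val ⁻¹' wset x) ∩ x.orbit ⁻¹' B) :=
    (hval (measurableSet_wset x)).inter (measurable_orbit x hB)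
  have := h (((Units.val ⁻¹' wset x) ∩ x.orbit ⁻¹' B).indicator 1)
    (B.indicator fun _ => totC p) (measurable_one.indicator hS) (measurable_const.indicator hB) ?_
  · rw [lintegral_indicator_one hS, lintegral_indicator_const hB] at this
    exact this.symm
  intro g
  rw [torus_lintegral x (measurable_one.indicator hS)]
  by_cases hg : x.orbit g ∈ B
  · rw [Set.indicator_of_mem hg, ← pi_wset1 x hs hn g, ← lintegral_indicator_one]
    · refine lintegral_congr_ae ?_
      filter_upwards [ae_ne_zero p] with t ht
      have h1 : x.torusParam t * g.1 = (torusUnit x hs hn t ht * g).1 := rfl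
      have h2 : x.orbit (torusUnit x hs hn t ht * g) = x.orbit g :=
        orbit_torusUnit x _ g (torusParam_comm x t)
      rw [h1, ext0_val]
      by_cases hw : (torusUnit x hs hn t ht * g).1 ∈ wset x
      · have hm : torusUnit x hs hn t ht * g ∈ (Units.val ⁻¹' wset x) ∩ x.orbit ⁻¹' B :=
          ⟨hw, by rwa [Set.mem_preimage, h2]⟩
        rw [Set.indicator_of_mem hm, Set.indicator_of_mem]
        · rfl
        · exact hw
      · have hm : torusUnit x hs hn t ht * g ∉ (Units.val ⁻¹' wset x) ∩ x.orbit ⁻¹' B :=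
          fun hh => hw hh.1
        rw [Set.indicator_of_notMem hm, Set.indicator_of_notMem]
        exact hw
    · exact (measurable_mat_mul.comp ((continuous_torusParam x).measurable.prodMk
        measurable_const)) (measurableSet_wset x)
  · rw [Set.indicator_of_notMem hg, ← lintegral_zero]
    refine lintegral_congr_ae ?_
    filter_upwards [ae_ne_zero p] with t ht
    have h1 : x.torusParam t * g.1 = (torusUnit x hs hn t ht * g).1 := rfl
    have h2 : x.orbit (torusUnit x hs hn t ht * g) = x.orbit g :=
        orbit_torusUnit x _ g (torusParam_comm x t)
    rw [h1, ext0_val, Set.indicator_of_notMem]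
    intro hh
    exact hg (by rw [← h2]; exact hh.2)

theorem exists_isQuotientMeasure (x : CharpolyFiber n p) (hs : p.Splits) (hn : p.roots.Nodup) :
    ∃ μ, x.IsQuotientMeasure μ := by
  have hval := (measurableEmbedding_val (n := n)).measurable
  have hW := measurableSet_wset x
  set π := Measure.pi (fun _ : p.roots.toFinset => multHaar) with hπ
  have hT := (continuous_torusParam x).measurable
  refine ⟨(totC p)⁻¹ • ((glHaar n).restrict (Units.val ⁻¹' wset x)).map x.orbit, ?_⟩
  intro f F hf hF hfF
  have hf0 := measurable_ext0 hf
  have hWm : Measurable ((wset x).indicator (1 : Matrix (Fin n) (Fin n) ℝ → ℝ≥0∞)) :=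
    measurable_one.indicator hW
  have hmul : Measurable fun q : Matrix (Fin n) (Fin n) ℝ × (p.roots.toFinset → ℝ) =>
      x.torusParam q.2 * q.1 :=
    measurable_mat_mul.comp ((hT.comp measurable_snd).prodMk measurable_fst)
  have hmul' : Measurable fun q : Matrix (Fin n) (Fin n) ℝ × (p.roots.toFinset → ℝ) =>
      x.torusParam q.2⁻¹ * q.1 :=
    measurable_mat_mul.comp ((hT.comp (measurable_snd.inv)).prodMk measurable_fst)
  have key : ∫⁻ A, ∫⁻ t, (wset x).indicator 1 A * ext0 f (x.torusParam t * A) ∂π ∂matrixHaar n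
      = totC p * ∫⁻ g, f g ∂glHaar n := by
    rw [lintegral_lintegral_swap]
    swap
    · exact ((hWm.comp measurable_fst).mul (hf0.comp hmul)).aemeasurable
    have e1 : ∫⁻ t, ∫⁻ A, (wset x).indicator 1 A * ext0 f (x.torusParam t * A) ∂matrixHaar n ∂π
        = ∫⁻ t, ∫⁻ A, (wset x).indicator 1 (x.torusParam t⁻¹ * A) * ext0 f A ∂matrixHaar n ∂π := by
      refine lintegral_congr_ae ?_
      filter_upwards [ae_ne_zero p] with t ht
      have hu := lmul_matrixHaar (torusUnit x hs hn t ht) (fun A =>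
        (wset x).indicator 1 (x.torusParam t⁻¹ * A) * ext0 f A)
        ((hWm.comp (measurable_mat_mul.comp (measurable_const.prodMk measurable_id))).mul hf0)
      rw [← hu]
      refine lintegral_congr fun A => ?_
      have h1 : x.torusParam t⁻¹ * ((torusUnit x hs hn t ht).1 * A) = A := by
        rw [← mul_assoc]
        change ((torusUnit x hs hn t ht)⁻¹.1 * (torusUnit x hs hn t ht).1) * A = A
        rw [Units.inv_mul, one_mul]
      rw [h1]
      rfl
    rw [e1, ← lintegral_lintegral_swap]
    swap
    · exact ((hWm.comp hmul').mul (hf0.comp measurable_fst)).aemeasurable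
    rw [glHaar, lintegral_comap_val, ← lintegral_const_mul _ hf0]
    refine lintegral_congr fun A => ?_
    by_cases hA : IsUnit A
    · obtain ⟨g, rfl⟩ := hA
      have hm : Measurable fun t : p.roots.toFinset → ℝ => x.torusParam t⁻¹ * g.1 :=
        measurable_mat_mul.comp ((hT.comp measurable_inv).prodMk measurable_const)
      have hc : Measurable fun t : p.roots.toFinset → ℝ =>
          (wset x).indicator (1 : Matrix (Fin n) (Fin n) ℝ → ℝ≥0∞) (x.torusParam t⁻¹ * g.1) :=
        hWm.comp hm
      rw [lintegral_mul_const _ hc, ← pi_wset2 x hs hn g, ← lintegral_indicator_one]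
      · rfl
      · exact hm hW
    · simp [ext0_not f hA]
  rw [lintegral_smul_measure, lintegral_map hF (measurable_orbit x),
    ← lintegral_indicator (hval hW)]
  have e2 : ∀ A, ext0 ((Units.val ⁻¹' wset x).indicator fun g => F (x.orbit g)) A
      = ∫⁻ t, (wset x).indicator 1 A * ext0 f (x.torusParam t * A) ∂π := by
    intro A
    by_cases hA : IsUnit A
    · obtain ⟨g, rfl⟩ := hA
      rw [ext0_val]
      by_cases hg : g.1 ∈ wset x
      · rw [Set.indicator_of_mem hg, Set.indicator_of_mem (by exact hg), hfF,
          torus_lintegral x hf]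
        simp [hπ]
      · rw [Set.indicator_of_notMem hg, Set.indicator_of_notMem (by exact hg)]
        simp
    · rw [ext0_not _ hA]
      have : ∀ t, ext0 f (x.torusParam t * A) = 0 := fun t => ext0_not f fun h => hA (by
        rw [Matrix.isUnit_iff_isUnit_det, Matrix.det_mul] at h
        rw [Matrix.isUnit_iff_isUnit_det]
        exact isUnit_of_mul_isUnit_right h)
      simp [this]
  have e3 : ∫⁻ g, (Units.val ⁻¹' wset x).indicator (fun g => F (x.orbit g)) g ∂glHaar n
      = totC p * ∫⁻ g, f g ∂glHaar n := by
    rw [← key, ← lintegral_congr e2, glHaar]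
    exact lintegral_comap_val _
  rw [e3, smul_eq_mul, ← mul_assoc,
    ENNReal.inv_mul_cancel totC_ne_zero totC_ne_top, one_mul]

theorem existsUnique_isQuotientMeasure (x : CharpolyFiber n p) (hs : p.Splits)
    (hn : p.roots.Nodup) : ∃! μ, x.IsQuotientMeasure μ := by
  obtain ⟨μ, hμ⟩ := exists_isQuotientMeasure x hs hn
  refine ⟨μ, hμ, fun ν hν => Measure.ext fun B hB => ?_⟩
  have h := (IsQuotientMeasure.apply x hs hn hν hB).trans
    (IsQuotientMeasure.apply x hs hn hμ hB).symm
  exact (ENNReal.mul_right_inj totC_ne_zero totC_ne_top).1 h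

end QuotientMeasure

open Classical in
/-- The measure `|ω_X|` on the fibre of the characteristic polynomial `p`, where `ω_X` is the
invariant form with `ω_{GL_n} = ω_X · ω_T` for the canonical forms of `GL_n` and of the split torus
`T = T_{x₀}`: it is the unique quotient measure. (It exists and is unique as soon as `p` has only
simple roots, all of them real, see `existsUnique_isQuotientMeasure`; otherwise the value of this
definition is irrelevant.) -/
noncomputable def CharpolyFiber.canMeasure {n : ℕ} {p : ℝ[X]} (x₀ : CharpolyFiber n p) :
    Measure (CharpolyFiber n p) :=
  if h : ∃ μ, x₀.IsQuotientMeasure μ then h.choose else 0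

theorem isQuotientMeasure_canMeasure {n : ℕ} {p : ℝ[X]} (x₀ : CharpolyFiber n p) (hs : p.Splits)
    (hn : p.roots.Nodup) : x₀.IsQuotientMeasure x₀.canMeasure := by
  have h := exists_isQuotientMeasure x₀ hs hn
  rw [CharpolyFiber.canMeasure, dif_pos h]
  exact h.choose_spec

/-- The set of real points `x` of norm `‖x‖ = √(∑ |x_ij|²) ≤ T`. -/
def normBall (n : ℕ) (p : ℝ[X]) (T : ℝ) : Set (CharpolyFiber n p) :=
  {x | √(∑ i, ∑ j, |x.1 i j| ^ 2) ≤ T}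

/-- The embedding of `𝓞 k` in the completion `k_v = ℝ` at an archimedean place `v` of a totally
real field `k`. -/
noncomputable def realEmb (k : Type*) [Field k] [IsTotallyReal k] (v : InfinitePlace k) :
    𝓞 k →+* ℝ :=
  (InfinitePlace.embedding_of_isReal (IsTotallyReal.isReal v)).comp (algebraMap (𝓞 k) k)

/-- The volume of `X(k_v, T) = {x ∈ X(k_v) | ‖x‖_v ≤ T}` for the measure `dμ_v`, where `X` is the
scheme of matrices with characteristic polynomial `χ` and `x₀` is the chosen base point of
`X(𝓞 k)`. -/
noncomputable def localVolume {k : Type*} [Field k] [IsTotallyReal k] {n : ℕ} {χ : (𝓞 k)[X]}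
    (x₀ : CharpolyFiber n χ) (v : InfinitePlace k) (T : ℝ) : ℝ≥0∞ :=
  (x₀.baseChange (realEmb k v)).canMeasure (normBall n (χ.map (realEmb k v)) T)

/-- The volume `w_n` of the unit ball in `ℝ^(n(n-1)/2)`. -/
noncomputable def unitBallVolume (n : ℕ) : ℝ :=
  (volume (Metric.ball (0 : EuclideanSpace ℝ (Fin (n * (n - 1) / 2))) 1)).toReal

end ArchVolume

/-! The asymptotics follow from an exact formula at each archimedean place, `canMeasure_normBall`.
If the real roots d_1, …, d_n are distinct and T ≥ 0, the ball of radius T has volume π^(n(n+1)/4) /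
∏ Γ(i/2) times ∏_{i<j} |d_i - d_j|⁻¹ times the Lebesgue volume of {c ∈ ℝ^(n(n-1)/2) : ∑ d_i² + |c|²
≤ T²}. For large T this last set is a ball of radius √(T² - ∑ d_i²), which is asymptotic to T.

To unfold the quotient measure, diagonalize x₀ by some a. The torus then acts on a g by scaling
rows, hence multiplies the pivots of the Gram matrix A Aᵀ of A = a g by t_i². Requiring all pivots
to lie in [1, 4) therefore cuts out of every torus orbit the same volume (2 log 2)ⁿ, and the volume
of the ball becomes an integral over `pivotSet`. Left invariance of Haar measure removes a.

What remains is the integral over `pivotSet` of |det A|⁻ⁿ F(‖A⁻¹ diag(d) A‖²), computed by induction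
on n in `lintegral_pivotSet_conjNormSq`; this is the Iwasawa decomposition without the orthogonal
group. The integrand depends only on A Aᵀ, so the rows may be rotated until the first one is (|v|,
0, …, 0) (`lintegral_gram_invariant`). By `conjNormSq_lowerBlock` the squared norm is then d_0²,
plus the same quantity for the lower right block, plus |M c|² for the rest c of the first column.
The Jacobian of c ↦ M c supplies the Vandermonde factors |d_i - d_0|⁻¹, and the integral over v is
the volume of a spherical shell, the source of π and Γ. The square of the Vandermonde product is
|Δ|.

Over k, total reality of K makes all roots real at every place, irreducibility makes them simple,
and the local limits are multiplied over the finitely many places. -/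

namespace ArchVolume

/-! ### Block lower triangular matrices -/

/-- The block lower triangular matrix with first row `(r, 0)` and remaining rows `(c, A)`. -/
def lowerBlock {n : ℕ} (r : ℝ) (c : Fin n → ℝ) (A : Matrix (Fin n) (Fin n) ℝ) :
    Matrix (Fin (n + 1)) (Fin (n + 1)) ℝ :=
  Matrix.of (Fin.cons (Fin.cons r 0) fun i => Fin.cons (c i) (A i))

section LowerBlock

variable {n : ℕ} (r : ℝ) (c : Fin n → ℝ) (A : Matrix (Fin n) (Fin n) ℝ)

@[simp] theorem lowerBlock_zero_zero : lowerBlock r c A 0 0 = r := rfl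
@[simp] theorem lowerBlock_zero_succ (j : Fin n) : lowerBlock r c A 0 j.succ = 0 := rfl
@[simp] theorem lowerBlock_succ_zero (i : Fin n) : lowerBlock r c A i.succ 0 = c i := rfl
@[simp] theorem lowerBlock_succ_succ (i j : Fin n) :
    lowerBlock r c A i.succ j.succ = A i j := rfl

theorem lowerBlock_mul (r' : ℝ) (c' : Fin n → ℝ) (A' : Matrix (Fin n) (Fin n) ℝ) :
    lowerBlock r c A * lowerBlock r' c' A' =
      lowerBlock (r * r') (r' • c + A *ᵥ c') (A * A') := by
  ext i j
  refine Fin.cases ?_ (fun i => ?_) i <;> refine Fin.cases ?_ (fun j => ?_) j <;>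
    simp [Matrix.mul_apply, Fin.sum_univ_succ, Matrix.mulVec, dotProduct, mul_comm]

theorem diagonal_eq_lowerBlock (d : Fin (n + 1) → ℝ) :
    Matrix.diagonal d = lowerBlock (d 0) 0 (Matrix.diagonal (Fin.tail d)) := by
  ext i j
  refine Fin.cases ?_ (fun i => ?_) i <;> refine Fin.cases ?_ (fun j => ?_) j <;>
    simp [Matrix.diagonal_apply, Fin.tail, Fin.succ_ne_zero, (Fin.succ_ne_zero _).symm]

@[simp] theorem det_lowerBlock : (lowerBlock r c A).det = r * A.det := by
  rw [Matrix.det_succ_row_zero, Fin.sum_univ_succ]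
  have : (lowerBlock r c A).submatrix Fin.succ Fin.succ = A := by ext; simp
  simp [this]

end LowerBlock

/-! ### Integration over rows and rotation invariance -/

/-- A rotation of `ℝⁿ⁺¹` moving `v` to the first coordinate axis. -/
theorem exists_rotation {n : ℕ} (v : Fin (n + 1) → ℝ) :
    ∃ R : (Fin (n + 1) → ℝ) → (Fin (n + 1) → ℝ), MeasurePreserving R ∧
      (∀ a b, R a ⬝ᵥ R b = a ⬝ᵥ b) ∧ R v = Fin.cons √(v ⬝ᵥ v) 0 := by
  set e : EuclideanSpace ℝ (Fin (n + 1)) := WithLp.toLp 2 (Fin.cons √(v ⬝ᵥ v) 0)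
  set w : EuclideanSpace ℝ (Fin (n + 1)) := WithLp.toLp 2 v
  have hnn : 0 ≤ v ⬝ᵥ v := by
    simp only [dotProduct, ← sq]
    positivity
  have hnorm : ‖w‖ = ‖e‖ := by
    rw [EuclideanSpace.norm_eq, EuclideanSpace.norm_eq, Fin.sum_univ_succ (n := n)]
    rw [Fin.sum_univ_succ (n := n)]
    simp only [e, w, Fin.cons_zero, Fin.cons_succ, Pi.zero_apply, norm_zero, Real.norm_eq_abs,
      sq_abs, Real.sq_sqrt hnn]
    simp [dotProduct, Fin.sum_univ_succ, sq]
  -- The reflection in the hyperplane orthogonal to w - e exchanges w and e, because they have the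
  -- same length; it is the identity if w = e.
  set L := (Submodule.reflection (ℝ ∙ (w - e))ᗮ)
  refine ⟨fun a => (L (WithLp.toLp 2 a)).ofLp, ?_, ?_, ?_⟩
  · exact (PiLp.volume_preserving_ofLp (Fin (n + 1))).comp
      (L.measurePreserving.comp (PiLp.volume_preserving_toLp (Fin (n + 1))))
  · intro a b
    have h := L.inner_map_map (WithLp.toLp 2 b) (WithLp.toLp 2 a)
    simp only [EuclideanSpace.inner_eq_star_dotProduct, star_trivial] at h
    exact h
  · exact congrArg WithLp.ofLp (Submodule.reflection_sub hnorm)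

theorem lintegral_pi_succ {n : ℕ} {α : Type} [MeasureSpace α]
    [SigmaFinite (volume : Measure α)] {f : (Fin (n + 1) → α) → ℝ≥0∞} (hf : Measurable f) :
    ∫⁻ A, f A = ∫⁻ v, ∫⁻ M, f (Fin.cons v M) := by
  have e := (volume_preserving_piFinSuccAbove (fun _ : Fin (n + 1) => α) 0).symm
  have hm : Measurable fun q : α × (Fin n → α) =>
      f ((MeasurableEquiv.piFinSuccAbove (fun _ : Fin (n + 1) => α) 0).symm q) :=
    hf.comp e.measurable
  rw [← e.lintegral_comp hf, Measure.volume_eq_prod, lintegral_prod _ hm.aemeasurable]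
  refine lintegral_congr fun v => lintegral_congr fun M => ?_
  change f (Fin.insertNth 0 v M) = _
  rw [Fin.insertNth_zero']

/-- Once the first row is fixed, this separates the first column c of the remaining rows from the
square block A. -/
theorem lintegral_rows {n m : ℕ} {f : (Fin m → Fin (n + 1) → ℝ) → ℝ≥0∞} (hf : Measurable f) :
    ∫⁻ M, f M = ∫⁻ A : Fin m → Fin n → ℝ, ∫⁻ c : Fin m → ℝ, f fun i => Fin.cons (c i) (A i) := by
  have e1 := volume_preserving_pi fun _ : Fin m =>
    (volume_preserving_piFinSuccAbove (fun _ : Fin (n + 1) => ℝ) 0).symm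
  have e2 := (volume_measurePreserving_arrowProdEquivProdArrow ℝ (Fin n → ℝ) (Fin m)).symm
  have e := e1.comp e2
  rw [← e.lintegral_comp hf]
  refine (lintegral_prod_symm _ (hf.comp e.measurable).aemeasurable).trans ?_
  refine lintegral_congr fun A => lintegral_congr fun c => ?_
  change f (fun i => Fin.insertNth 0 (c i) (A i)) = _
  simp only [Fin.insertNth_zero']

/-- Integration over square matrices of a function of the Gram matrix of the rows. -/
theorem lintegral_gram_invariant {n : ℕ} {f : Matrix (Fin (n + 1)) (Fin (n + 1)) ℝ → ℝ≥0∞}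
    (hf : Measurable f) (hinv : ∀ A B, A * Aᵀ = B * Bᵀ → f A = f B) :
    ∫⁻ A, f A = ∫⁻ v : Fin (n + 1) → ℝ, ∫⁻ A : Matrix (Fin n) (Fin n) ℝ, ∫⁻ c : Fin n → ℝ,
      f (lowerBlock √(v ⬝ᵥ v) c A) := by
  refine (lintegral_pi_succ (α := Fin (n + 1) → ℝ) hf).trans (lintegral_congr fun v => ?_)
  obtain ⟨R, hR, hRdot, hRv⟩ := exists_rotation v
  have e := volume_preserving_pi fun _ : Fin n => hR
  set g : (Fin n → Fin (n + 1) → ℝ) → ℝ≥0∞ :=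
    fun M => f (Matrix.of (Fin.cons (Fin.cons √(v ⬝ᵥ v) 0) M)) with hg
  have hgm : Measurable g := by
    refine hf.comp ?_
    refine measurable_pi_lambda _ fun i => ?_
    refine Fin.cases ?_ (fun i => ?_) i
    · exact measurable_const
    · exact measurable_pi_apply i
  -- Applying the same isometry to all rows preserves the Gram matrix, hence f, and on the rows
  -- other than v it preserves Lebesgue measure.
  have h1 : ∫⁻ M : Fin n → Fin (n + 1) → ℝ, f (Fin.cons v M) = ∫⁻ M, g M := by
    rw [← e.lintegral_comp hgm]
    refine lintegral_congr fun M => hinv _ _ ?_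
    ext i j
    change (Fin.cons v M : Fin (n + 1) → _) i ⬝ᵥ (Fin.cons v M : Fin (n + 1) → _) j =
      (Fin.cons (Fin.cons √(v ⬝ᵥ v) 0) fun i => R (M i) : Fin (n + 1) → Fin (n + 1) → ℝ) i ⬝ᵥ
      (Fin.cons (Fin.cons √(v ⬝ᵥ v) 0) fun i => R (M i) : Fin (n + 1) → Fin (n + 1) → ℝ) j
    rw [← hRv]
    refine Fin.cases ?_ (fun i => ?_) i <;> refine Fin.cases ?_ (fun j => ?_) j <;> simp [hRdot]
  exact h1.trans (lintegral_rows hgm)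

/-- Every square matrix has the Gram matrix of a block lower triangular matrix. -/
theorem exists_lowerBlock_gram {n : ℕ} (A : Matrix (Fin (n + 1)) (Fin (n + 1)) ℝ) :
    ∃ r c A', A * Aᵀ = lowerBlock r c A' * (lowerBlock r c A')ᵀ := by
  obtain ⟨R, -, hRdot, hRv⟩ := exists_rotation (A 0)
  refine ⟨√(A 0 ⬝ᵥ A 0), fun i => R (A i.succ) 0, fun i j => R (A i.succ) j.succ, ?_⟩
  have h : ∀ i, (lowerBlock √(A 0 ⬝ᵥ A 0) (fun i => R (A i.succ) 0)
      fun i j => R (A i.succ) j.succ) i = R (A i) := by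
    intro i
    refine Fin.cases (hRv ▸ rfl) (fun i => ?_) i
    exact Fin.cons_self_tail (R (A i.succ))
  ext i j
  change A i ⬝ᵥ A j = _ ⬝ᵥ lowerBlock _ _ _ j
  rw [h, h, hRdot]

/-! ### Schur complements and pivots of Gram matrices -/

/-- The Schur complement of the first diagonal entry. -/
noncomputable def schur {n : ℕ} (S : Matrix (Fin (n + 1)) (Fin (n + 1)) ℝ) :
    Matrix (Fin n) (Fin n) ℝ :=
  Matrix.of fun i j => S i.succ j.succ - S i.succ 0 * S 0 j.succ / S 0 0

/-- The successive pivots of Gaussian elimination. -/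
noncomputable def pivots : (n : ℕ) → Matrix (Fin n) (Fin n) ℝ → Fin n → ℝ
  | 0, _ => Fin.elim0
  | n + 1, S => Fin.cons (S 0 0) (pivots n (schur S))

theorem measurable_schur {n : ℕ} : Measurable (schur (n := n)) := by
  refine measurable_pi_lambda _ fun i => measurable_pi_lambda _ fun j => ?_
  have h : ∀ i j, Measurable fun S : Matrix (Fin (n + 1)) (Fin (n + 1)) ℝ => S i j :=
    fun i j => (continuous_id.matrix_elem i j).measurable
  exact (h _ _).sub (((h _ _).mul (h _ _)).div (h _ _))

theorem measurable_pivots (n : ℕ) (i : Fin n) : Measurable fun S => pivots n S i := by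
  induction n with
  | zero => exact i.elim0
  | succ n ih =>
    refine Fin.cases ?_ (fun i => ?_) i
    · exact (continuous_id.matrix_elem 0 0).measurable
    · exact (ih i).comp measurable_schur

/-- The lower right block of the Gram matrix is c cᵀ + A Aᵀ, and the correction term (c_i r)(r c_j)
/ r² removes exactly c cᵀ. -/
theorem schur_lowerBlock_gram {n : ℕ} {r : ℝ} (hr : r ≠ 0) (c : Fin n → ℝ)
    (A : Matrix (Fin n) (Fin n) ℝ) :
    schur (lowerBlock r c A * (lowerBlock r c A)ᵀ) = A * Aᵀ := by
  ext i j
  simp only [schur, Matrix.of_apply, Matrix.mul_apply, Fin.sum_univ_succ, Matrix.transpose_apply,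
    lowerBlock_zero_zero, lowerBlock_zero_succ, lowerBlock_succ_zero, lowerBlock_succ_succ]
  simp only [mul_zero, zero_mul, Finset.sum_const_zero, add_zero]
  field_simp
  ring

theorem lowerBlock_gram_zero_zero {n : ℕ} (r : ℝ) (c : Fin n → ℝ) (A : Matrix (Fin n) (Fin n) ℝ) :
    (lowerBlock r c A * (lowerBlock r c A)ᵀ) 0 0 = r ^ 2 := by
  simp [Matrix.mul_apply, Fin.sum_univ_succ, sq]

theorem pivots_lowerBlock_gram {n : ℕ} {r : ℝ} (hr : r ≠ 0) (c : Fin n → ℝ)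
    (A : Matrix (Fin n) (Fin n) ℝ) :
    pivots (n + 1) (lowerBlock r c A * (lowerBlock r c A)ᵀ) =
      Fin.cons (r ^ 2) (pivots n (A * Aᵀ)) := by
  rw [pivots, schur_lowerBlock_gram hr, lowerBlock_gram_zero_zero]

theorem abs_det_eq_of_gram_eq {n : ℕ} {A B : Matrix (Fin n) (Fin n) ℝ} (h : A * Aᵀ = B * Bᵀ) :
    |A.det| = |B.det| := by
  have := congrArg Matrix.det h
  simp only [Matrix.det_mul, Matrix.det_transpose] at this
  exact abs_eq_abs.2 (mul_self_eq_mul_self_iff.1 this)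

/-- After rotation to block triangular form the first pivot is r², with r ≠ 0 by the determinant,
and the others are the pivots of a smaller invertible block. -/
theorem pivots_gram_pos {n : ℕ} {A : Matrix (Fin n) (Fin n) ℝ} (hA : A.det ≠ 0) (i : Fin n) :
    0 < pivots n (A * Aᵀ) i := by
  induction n with
  | zero => exact i.elim0
  | succ n ih =>
    obtain ⟨r, c, A', h⟩ := exists_lowerBlock_gram A
    have hd : (lowerBlock r c A').det ≠ 0 := by
      rwa [← abs_ne_zero, ← abs_det_eq_of_gram_eq h, abs_ne_zero]
    rw [det_lowerBlock] at hd
    obtain ⟨hr, hA'⟩ := mul_ne_zero_iff.1 hd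
    rw [h, pivots_lowerBlock_gram hr]
    refine Fin.cases ?_ (fun i => ?_) i
    · simp only [Fin.cons_zero]
      positivity
    · exact ih hA' i

/-- Taking Schur complements commutes with conjugation by a diagonal matrix: the factors t_0² cancel
in the correction term. This describes the action of the torus on pivots. -/
theorem pivots_diagonal_conj {n : ℕ} {t : Fin n → ℝ} (ht : ∀ i, t i ≠ 0)
    (S : Matrix (Fin n) (Fin n) ℝ) (i : Fin n) :
    pivots n (Matrix.diagonal t * S * Matrix.diagonal t) i = t i ^ 2 * pivots n S i := by
  induction n with
  | zero => exact i.elim0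
  | succ n ih =>
    have h : schur (Matrix.diagonal t * S * Matrix.diagonal t) =
        Matrix.diagonal (Fin.tail t) * schur S * Matrix.diagonal (Fin.tail t) := by
      ext i j
      have := ht 0
      simp only [schur, Matrix.of_apply, Matrix.diagonal_mul, Matrix.mul_diagonal, Fin.tail]
      -- If the first pivot is 0, both correction terms are 0 since division by 0 gives 0.
      rcases eq_or_ne (S 0 0) 0 with h0 | h0
      · simp [h0]
      · field_simp
    refine Fin.cases ?_ (fun i => ?_) i
    · simp only [pivots, Fin.cons_zero, Matrix.diagonal_mul, Matrix.mul_diagonal]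
      ring
    · simp only [pivots, Fin.cons_succ, h]
      exact ih (fun i => ht i.succ) _ i

/-! ### The norm of a conjugated diagonal matrix -/

/-- The square of the norm of `A⁻¹ diag(d) A`. -/
noncomputable def conjNormSq {n : ℕ} (d : Fin n → ℝ) (A : Matrix (Fin n) (Fin n) ℝ) : ℝ :=
  ∑ i, ∑ j, (A⁻¹ * Matrix.diagonal d * A) i j ^ 2

/-- From ‖M‖² = tr(M Mᵀ) and cyclicity of the trace. It shows that the norm depends on A only
through its Gram matrix, as rotation of the rows requires. -/
theorem conjNormSq_eq_trace {n : ℕ} (d : Fin n → ℝ) (A : Matrix (Fin n) (Fin n) ℝ) :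
    conjNormSq d A =
      ((A * Aᵀ)⁻¹ * Matrix.diagonal d * (A * Aᵀ) * Matrix.diagonal d).trace := by
  have h : ∀ M : Matrix (Fin n) (Fin n) ℝ, ∑ i, ∑ j, M i j ^ 2 = (M * Mᵀ).trace := fun M => by
    simp [Matrix.trace, Matrix.mul_apply, sq]
  rw [conjNormSq, h, Matrix.mul_inv_rev, Matrix.transpose_mul, Matrix.transpose_mul,
    Matrix.diagonal_transpose, Matrix.transpose_nonsing_inv]
  simp only [← mul_assoc]
  rw [Matrix.trace_mul_comm]
  simp only [← mul_assoc]

/-- The conjugate is again block lower triangular, with column w = A⁻¹ diag(d_{i+1} - d_0) c, which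
is linear in c and does not involve r. -/
theorem conjNormSq_lowerBlock {n : ℕ} (d : Fin (n + 1) → ℝ) {r : ℝ} (hr : r ≠ 0) (c : Fin n → ℝ)
    {A : Matrix (Fin n) (Fin n) ℝ} (hA : A.det ≠ 0) :
    conjNormSq d (lowerBlock r c A) = d 0 ^ 2 + conjNormSq (Fin.tail d) A +
      (A⁻¹ * Matrix.diagonal fun i => d i.succ - d 0) *ᵥ c ⬝ᵥ
        (A⁻¹ * Matrix.diagonal fun i => d i.succ - d 0) *ᵥ c := by
  have hA' : IsUnit A.det := isUnit_iff_ne_zero.2 hA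
  have hB : IsUnit (lowerBlock r c A).det := by
    rw [det_lowerBlock]
    exact isUnit_iff_ne_zero.2 (mul_ne_zero hr hA)
  set w := (A⁻¹ * Matrix.diagonal fun i => d i.succ - d 0) *ᵥ c with hw
  have h : (lowerBlock r c A)⁻¹ * Matrix.diagonal d * lowerBlock r c A =
      lowerBlock (d 0) w (A⁻¹ * Matrix.diagonal (Fin.tail d) * A) := by
    -- With B the block matrix, this reduces the claim to diag(d) B = B · (claimed conjugate),
    -- compared block by block; the column entry is d_{i+1} c_i = d_0 c_i + (A w)_i.
    rw [mul_assoc, ← Matrix.nonsing_inv_mul_cancel_left _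
      (lowerBlock (d 0) w (A⁻¹ * Matrix.diagonal (Fin.tail d) * A)) hB]
    congr 1
    rw [diagonal_eq_lowerBlock, lowerBlock_mul, lowerBlock_mul, hw, Matrix.mulVec_mulVec,
      Matrix.mul_nonsing_inv_cancel_left _ _ hA', mul_assoc A⁻¹,
      Matrix.mul_nonsing_inv_cancel_left _ _ hA']
    congr 1
    · ring
    · ext i
      simp [Matrix.mulVec_diagonal, Fin.tail]
      ring
  rw [conjNormSq, h, conjNormSq]
  simp only [Fin.sum_univ_succ, lowerBlock_zero_zero, lowerBlock_zero_succ, lowerBlock_succ_zero,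
    lowerBlock_succ_succ, dotProduct, Finset.sum_add_distrib]
  simp [sq]
  ring

/-- Concatenation of coordinates preserves Lebesgue measure and adds squared lengths. In the
induction it joins the new column to the coordinates already collected. -/
theorem lintegral_dotProduct_add {a b m : ℕ} (hm : m = a + b) {G : ℝ → ℝ≥0∞} (hG : Measurable G) :
    ∫⁻ c : Fin a → ℝ, ∫⁻ y : Fin b → ℝ, G (c ⬝ᵥ c + y ⬝ᵥ y) = ∫⁻ z : Fin m → ℝ, G (z ⬝ᵥ z) := by
  subst hm
  have e1 := volume_measurePreserving_sumPiEquivProdPi fun _ : Fin a ⊕ Fin b => ℝ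
  have e2 := (volume_measurePreserving_piCongrLeft (fun _ : Fin (a + b) => ℝ)
    (finSumFinEquiv (m := a) (n := b)))
  have hd : ∀ k, Measurable fun c : Fin k → ℝ => c ⬝ᵥ c := fun k =>
    (Continuous.dotProduct continuous_id continuous_id).measurable
  have hG' : Measurable fun q : (Fin a → ℝ) × (Fin b → ℝ) => G (q.1 ⬝ᵥ q.1 + q.2 ⬝ᵥ q.2) :=
    hG.comp (((hd a).comp measurable_fst).add ((hd b).comp measurable_snd))
  have e3 := e2.lintegral_comp (hG.comp (hd _))
  simp only [Function.comp_def] at e3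
  rw [← e3, ← lintegral_prod _ hG'.aemeasurable,
    ← Measure.volume_eq_prod]
  have := e1.lintegral_comp hG'
  rw [show (volume : Measure ((Fin a → ℝ) × (Fin b → ℝ))) = volume from rfl] at this
  refine this.symm.trans (lintegral_congr fun z => congrArg G ?_)
  simp only [dotProduct, MeasurableEquiv.coe_piCongrLeft]
  rw [← (finSumFinEquiv (m := a) (n := b)).sum_comp, Fintype.sum_sum_type]
  simp only [Equiv.piCongrLeft_apply_apply]
  rfl

theorem lintegral_comp_mulVec {n : ℕ} {M : Matrix (Fin n) (Fin n) ℝ} (hM : M.det ≠ 0)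
    {G : (Fin n → ℝ) → ℝ≥0∞} (hG : Measurable G) :
    ∫⁻ c, G (M *ᵥ c) = ENNReal.ofReal |M.det|⁻¹ * ∫⁻ c, G c := by
  have h := Real.map_matrix_volume_pi_eq_smul_volume_pi hM
  have hm : Measurable (Matrix.toLin' M) :=
    (LinearMap.continuous_of_finiteDimensional _).measurable
  have := lintegral_map (μ := volume) hG hm
  rw [h, lintegral_smul_measure, abs_inv] at this
  exact this.symm

/-! ### The integral over the pivot set -/

/-- The product of the absolute values of the differences of the `d i`. -/
noncomputable def absVandermonde : (n : ℕ) → (Fin n → ℝ) → ℝ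
  | 0, _ => 1
  | n + 1, d => (∏ i : Fin n, |d i.succ - d 0|) * absVandermonde n (Fin.tail d)

theorem absVandermonde_sq {n : ℕ} (d : Fin n → ℝ) :
    absVandermonde n d ^ 2 = ∏ i, ∏ j ∈ Finset.univ.erase i, |d i - d j| := by
  have key : ∀ (n : ℕ) (d : Fin n → ℝ), absVandermonde n d ^ 2 =
      ∏ i, ∏ j, if i = j then 1 else |d i - d j| := by
    intro n
    induction n with
    | zero => intro d; simp [absVandermonde]
    | succ n ih =>
      intro d
      simp only [absVandermonde, mul_pow, ih, Fin.prod_univ_succ, if_true, one_mul,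
        Fin.succ_ne_zero, (Fin.succ_ne_zero _).symm, if_false, Fin.succ_inj, Fin.tail,
        Finset.prod_mul_distrib, abs_sub_comm (d 0)]
      ring
  rw [key]
  refine Finset.prod_congr rfl fun i _ => ?_
  rw [← Finset.mul_prod_erase _ _ (Finset.mem_univ i), if_pos rfl, one_mul]
  exact Finset.prod_congr rfl fun j hj => if_neg (Finset.ne_of_mem_erase hj).symm

/-- The set of matrices whose Gram matrix has all pivots in `[1, 4)`. -/
def pivotSet (n : ℕ) : Set (Matrix (Fin n) (Fin n) ℝ) :=
  {A | ∀ i, 1 ≤ pivots n (A * Aᵀ) i ∧ pivots n (A * Aᵀ) i < 4}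

theorem measurable_gram (n : ℕ) : Measurable fun A : Matrix (Fin n) (Fin n) ℝ => A * Aᵀ :=
  (continuous_id.matrix_mul continuous_id.matrix_transpose).measurable

theorem measurableSet_pivotSet (n : ℕ) : MeasurableSet (pivotSet n) := by
  unfold pivotSet
  simp only [Set.ofPred_forall]
  refine MeasurableSet.iInter fun i => ?_
  have := (measurable_pivots n i).comp (measurable_gram n)
  exact (measurableSet_le measurable_const this).inter (measurableSet_lt this measurable_const)

theorem measurable_matrix_inv {n : ℕ} :
    Measurable fun A : Matrix (Fin n) (Fin n) ℝ => A⁻¹ := by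
  simp only [Matrix.inv_def, Ring.inverse_eq_inv']
  exact measurable_det.inv.smul (continuous_id.matrix_adjugate.measurable)

theorem measurable_conjNormSq {n : ℕ} (d : Fin n → ℝ) : Measurable (conjNormSq d) := by
  have h : Measurable fun A : Matrix (Fin n) (Fin n) ℝ => A⁻¹ * Matrix.diagonal d * A :=
    measurable_mat_mul.comp ((measurable_mat_mul.comp
      (measurable_matrix_inv.prodMk measurable_const)).prodMk measurable_id)
  refine Finset.measurable_sum _ fun i _ => Finset.measurable_sum _ fun j _ => ?_
  exact ((continuous_id.matrix_elem i j).measurable.comp h).pow_const 2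

/-- The volume of the spherical shell `1 ≤ |v| < 2` for the measure `|v|⁻ⁿ dv`. -/
noncomputable def shellVolume (n : ℕ) : ℝ≥0∞ :=
  ∫⁻ v : Fin n → ℝ, {v : Fin n → ℝ | 1 ≤ v ⬝ᵥ v ∧ v ⬝ᵥ v < 4}.indicator
    (fun v => ENNReal.ofReal (√(v ⬝ᵥ v) ^ n)⁻¹) v

theorem lowerBlock_mem_pivotSet {n : ℕ} {r : ℝ} {c : Fin n → ℝ} {A : Matrix (Fin n) (Fin n) ℝ} :
    lowerBlock r c A ∈ pivotSet (n + 1) ↔ (1 ≤ r ^ 2 ∧ r ^ 2 < 4) ∧ A ∈ pivotSet n := by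
  rcases eq_or_ne r 0 with rfl | hr
  -- For r = 0 both sides fail, because the first pivot is 0 < 1.
  · refine ⟨fun h => ?_, fun h => ?_⟩
    · have := (h 0).1
      rw [pivots, Fin.cons_zero, lowerBlock_gram_zero_zero] at this
      norm_num at this
    · norm_num at h
  · simp only [pivotSet, Set.mem_ofPred_eq, pivots_lowerBlock_gram hr, Fin.forall_fin_succ,
      Fin.cons_zero, Fin.cons_succ]

/-- The inductive step for fixed v and A: substitute c ↦ M c with M = A⁻¹ diag(d_{i+1} - d_0). The
Jacobian contributes |det A| / ∏ |d_{i+1} - d_0|, lowering the exponent of |det A| from n + 1 to the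
n that belongs to the smaller block. -/
theorem lintegral_column {n : ℕ} {d : Fin (n + 1) → ℝ} (hd : Function.Injective d)
    {F : ℝ → ℝ≥0∞} (hF : Measurable F) (v : Fin (n + 1) → ℝ) (A : Matrix (Fin n) (Fin n) ℝ) :
    ∫⁻ c : Fin n → ℝ, (pivotSet (n + 1)).indicator (fun B => ENNReal.ofReal (|B.det| ^ (n + 1))⁻¹ *
        F (conjNormSq d B)) (lowerBlock √(v ⬝ᵥ v) c A) =
      {v : Fin (n + 1) → ℝ | 1 ≤ v ⬝ᵥ v ∧ v ⬝ᵥ v < 4}.indicator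
        (fun v => ENNReal.ofReal (√(v ⬝ᵥ v) ^ (n + 1))⁻¹) v *
      (ENNReal.ofReal (∏ i : Fin n, |d i.succ - d 0|)⁻¹ *
      ∫⁻ c : Fin n → ℝ, (pivotSet n).indicator (fun A => ENNReal.ofReal (|A.det| ^ n)⁻¹ *
        F (d 0 ^ 2 + c ⬝ᵥ c + conjNormSq (Fin.tail d) A)) A) := by
  have hnn : 0 ≤ v ⬝ᵥ v := by
    simp only [dotProduct, ← sq]
    positivity
  have hmem : ∀ c, lowerBlock √(v ⬝ᵥ v) c A ∈ pivotSet (n + 1) ↔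
      (1 ≤ v ⬝ᵥ v ∧ v ⬝ᵥ v < 4) ∧ A ∈ pivotSet n := by
    intro c
    rw [lowerBlock_mem_pivotSet, Real.sq_sqrt hnn]
  by_cases hv : v ∈ {v : Fin (n + 1) → ℝ | 1 ≤ v ⬝ᵥ v ∧ v ⬝ᵥ v < 4}
  swap
  · rw [Set.indicator_of_notMem hv, zero_mul]
    refine (lintegral_congr fun c => ?_).trans lintegral_zero
    exact Set.indicator_of_notMem (fun h => hv ((hmem c).1 h).1) _
  by_cases hA : A ∈ pivotSet n
  swap
  · simp only [Set.indicator_of_notMem hA, lintegral_zero, mul_zero]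
    refine (lintegral_congr fun c => ?_).trans lintegral_zero
    exact Set.indicator_of_notMem (fun h => hA ((hmem c).1 h).2) _
  have hr : √(v ⬝ᵥ v) ≠ 0 := (Real.sqrt_pos.2 (lt_of_lt_of_le one_pos hv.1)).ne'
  have hind : ∀ c, (pivotSet (n + 1)).indicator (fun B => ENNReal.ofReal (|B.det| ^ (n + 1))⁻¹ *
      F (conjNormSq d B)) (lowerBlock √(v ⬝ᵥ v) c A) =
      ENNReal.ofReal (|√(v ⬝ᵥ v) * A.det| ^ (n + 1))⁻¹ *
        F (conjNormSq d (lowerBlock √(v ⬝ᵥ v) c A)) := by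
    intro c
    rw [Set.indicator_of_mem ((hmem c).2 ⟨hv, hA⟩), det_lowerBlock]
  simp only [hind, Set.indicator_of_mem hv, Set.indicator_of_mem hA]
  -- For singular A both weights are 0, as 0⁻¹ = 0; here n ≠ 0 because the empty determinant is 1.
  by_cases hdet : A.det = 0
  · have hn : n ≠ 0 := by
      rintro rfl
      simp at hdet
    simp [hdet, hn]
  have hP : 0 < ∏ i : Fin n, |d i.succ - d 0| := Finset.prod_pos fun i _ =>
    abs_pos.2 (sub_ne_zero.2 fun h => Fin.succ_ne_zero i (hd h))
  have hdot : Measurable fun c : Fin n → ℝ => c ⬝ᵥ c :=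
    (Continuous.dotProduct continuous_id continuous_id).measurable
  set M : Matrix (Fin n) (Fin n) ℝ := A⁻¹ * Matrix.diagonal fun i => d i.succ - d 0 with hM
  have hMdet : |M.det| = |A.det|⁻¹ * ∏ i : Fin n, |d i.succ - d 0| := by
    rw [hM, Matrix.det_mul, Matrix.det_diagonal, Matrix.det_nonsing_inv, Ring.inverse_eq_inv',
      abs_mul, abs_inv, Finset.abs_prod]
  have hM0 : M.det ≠ 0 := by
    rw [← abs_pos, hMdet]
    have := abs_pos.2 hdet
    positivity
  have hG : Measurable fun c : Fin n → ℝ =>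
      F (d 0 ^ 2 + c ⬝ᵥ c + conjNormSq (Fin.tail d) A) :=
    hF.comp ((measurable_const.add hdot).add measurable_const)
  have hsub := lintegral_comp_mulVec hM0 hG
  simp only [conjNormSq_lowerBlock d hr _ hdet, ← hM, add_right_comm (d 0 ^ 2) (conjNormSq _ A)]
  rw [lintegral_const_mul' _ _ ENNReal.ofReal_ne_top, hsub,
    lintegral_const_mul' _ _ ENNReal.ofReal_ne_top, ← mul_assoc, ← mul_assoc, ← mul_assoc,
    ← ENNReal.ofReal_mul (by positivity), ← ENNReal.ofReal_mul (by positivity),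
    ← ENNReal.ofReal_mul (by positivity), hMdet, abs_mul, abs_of_nonneg (Real.sqrt_nonneg _)]
  congr 2
  have := abs_pos.2 hdet
  have hr' := abs_pos.2 hr
  field_simp
  ring

theorem measurable_weight {n : ℕ} (d : Fin n → ℝ) {F : ℝ → ℝ≥0∞} (hF : Measurable F) :
    Measurable ((pivotSet n).indicator fun A => ENNReal.ofReal (|A.det| ^ n)⁻¹ *
      F (conjNormSq d A)) := by
  have := measurable_det (n := n)
  refine Measurable.indicator (Measurable.mul ?_ (hF.comp (measurable_conjNormSq d)))
    (measurableSet_pivotSet n)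
  fun_prop

/-- Allowing an arbitrary F makes the induction close: the terms d_0² + |c|² split off at each stage
are absorbed into a translate of F. -/
theorem lintegral_pivotSet_conjNormSq (n : ℕ) {d : Fin n → ℝ} (hd : Function.Injective d)
    {F : ℝ → ℝ≥0∞} (hF : Measurable F) :
    ∫⁻ A, (pivotSet n).indicator (fun A => ENNReal.ofReal (|A.det| ^ n)⁻¹ *
        F (conjNormSq d A)) A =
      (∏ i ∈ Finset.range n, shellVolume (i + 1)) * ENNReal.ofReal (absVandermonde n d)⁻¹ *
        ∫⁻ c : Fin (n * (n - 1) / 2) → ℝ, F (d ⬝ᵥ d + c ⬝ᵥ c) := by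
  induction n generalizing F with
  | zero =>
    -- In size 0 both Lebesgue measures are point masses and all products are empty.
    have e1 : (volume : Measure (Matrix (Fin 0) (Fin 0) ℝ)) = Measure.dirac 0 :=
      Measure.pi_of_empty _ _
    have e2 : (volume : Measure (Fin (0 * (0 - 1) / 2) → ℝ)) = Measure.dirac 0 :=
      Measure.pi_of_empty (α := Fin 0) _ _
    have h0 : (0 : Matrix (Fin 0) (Fin 0) ℝ) ∈ pivotSet 0 := fun i => i.elim0
    rw [e1, e2, lintegral_dirac' _ (measurable_weight d hF),
      lintegral_dirac, Set.indicator_of_mem h0]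
    simp [absVandermonde, conjNormSq, dotProduct]
  | succ n ih =>
    have hdot : ∀ k, Measurable fun c : Fin k → ℝ => c ⬝ᵥ c := fun k =>
      (Continuous.dotProduct continuous_id continuous_id).measurable
    have hinv : ∀ A B : Matrix (Fin (n + 1)) (Fin (n + 1)) ℝ, A * Aᵀ = B * Bᵀ →
        (pivotSet (n + 1)).indicator (fun A => ENNReal.ofReal (|A.det| ^ (n + 1))⁻¹ *
          F (conjNormSq d A)) A =
        (pivotSet (n + 1)).indicator (fun A => ENNReal.ofReal (|A.det| ^ (n + 1))⁻¹ *
          F (conjNormSq d A)) B := by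
      intro A B h
      have hm : A ∈ pivotSet (n + 1) ↔ B ∈ pivotSet (n + 1) := by
        simp only [pivotSet, Set.mem_ofPred_eq, h]
      by_cases hB : B ∈ pivotSet (n + 1)
      · rw [Set.indicator_of_mem hB, Set.indicator_of_mem (hm.2 hB), abs_det_eq_of_gram_eq h,
          conjNormSq_eq_trace, conjNormSq_eq_trace, h]
      · rw [Set.indicator_of_notMem hB, Set.indicator_of_notMem fun h => hB (hm.1 h)]
    have hd' : Function.Injective (Fin.tail d) := hd.comp (Fin.succ_injective n)
    have hjoint : Measurable fun q : Matrix (Fin n) (Fin n) ℝ × (Fin n → ℝ) =>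
        (pivotSet n).indicator (fun A => ENNReal.ofReal (|A.det| ^ n)⁻¹ *
          F (d 0 ^ 2 + q.2 ⬝ᵥ q.2 + conjNormSq (Fin.tail d) A)) q.1 := by
      have h1 := measurable_det (n := n)
      have h2 := measurable_conjNormSq (Fin.tail d)
      have h3 : Measurable fun q : Matrix (Fin n) (Fin n) ℝ × (Fin n → ℝ) =>
          ENNReal.ofReal (|q.1.det| ^ n)⁻¹ *
          F (d 0 ^ 2 + q.2 ⬝ᵥ q.2 + conjNormSq (Fin.tail d) q.1) := by
        refine Measurable.mul ?_ (hF.comp ((measurable_const.add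
          ((hdot n).comp measurable_snd)).add (h2.comp measurable_fst)))
        fun_prop
      exact h3.indicator (measurable_fst (measurableSet_pivotSet n))
    have hF' : ∀ s : ℝ, Measurable fun x => F (s + x) := fun s =>
      hF.comp (measurable_const.add measurable_id)
    rw [lintegral_gram_invariant (measurable_weight d hF) hinv]
    simp only [lintegral_column hd hF]
    have hshell : Measurable fun v : Fin (n + 1) → ℝ =>
        {v : Fin (n + 1) → ℝ | 1 ≤ v ⬝ᵥ v ∧ v ⬝ᵥ v < 4}.indicator
          (fun v => ENNReal.ofReal (√(v ⬝ᵥ v) ^ (n + 1))⁻¹) v := by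
      have := hdot (n + 1)
      refine Measurable.indicator (by fun_prop) ?_
      exact (measurableSet_le measurable_const this).inter (measurableSet_lt this measurable_const)
    have hin : Measurable fun A : Matrix (Fin n) (Fin n) ℝ => ∫⁻ c : Fin n → ℝ,
        (pivotSet n).indicator (fun A => ENNReal.ofReal (|A.det| ^ n)⁻¹ *
          F (d 0 ^ 2 + c ⬝ᵥ c + conjNormSq (Fin.tail d) A)) A :=
      hjoint.lintegral_prod_right'
    have hswap : ∫⁻ A : Matrix (Fin n) (Fin n) ℝ, ∫⁻ c : Fin n → ℝ,
        (pivotSet n).indicator (fun A => ENNReal.ofReal (|A.det| ^ n)⁻¹ *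
          F (d 0 ^ 2 + c ⬝ᵥ c + conjNormSq (Fin.tail d) A)) A =
        (∏ i ∈ Finset.range n, shellVolume (i + 1)) *
          ENNReal.ofReal (absVandermonde n (Fin.tail d))⁻¹ *
          ∫⁻ c : Fin ((n + 1) * (n + 1 - 1) / 2) → ℝ, F (d ⬝ᵥ d + c ⬝ᵥ c) := by
      -- With c outermost, the induction hypothesis applies to F translated by d_0² + |c|².
      rw [lintegral_lintegral_swap hjoint.aemeasurable,
        lintegral_congr fun c : Fin n → ℝ => ih hd' (hF' (d 0 ^ 2 + c ⬝ᵥ c))]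
      -- The n entries of the new column raise the dimension to the next triangular number; n = 0 is
      -- separate because of truncated subtraction.
      have hm : (n + 1) * (n + 1 - 1) / 2 = n + n * (n - 1) / 2 := by
        rcases n with _ | n
        · rfl
        · have : (n + 1 + 1) * (n + 1 + 1 - 1) = (n + 1) * (n + 1 - 1) + (n + 1) * 2 := by
            simp only [Nat.add_sub_cancel]
            ring
          rw [this, Nat.add_mul_div_right _ _ two_pos, add_comm]
      rw [← lintegral_dotProduct_add hm (hF' (d ⬝ᵥ d)), ← lintegral_const_mul]
      · refine lintegral_congr fun c => ?_
        congr 1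
        refine lintegral_congr fun y => congrArg F ?_
        simp only [dotProduct, Fin.sum_univ_succ, Fin.tail, sq]
        ring
      · refine Measurable.lintegral_prod_right' (f := fun q : (Fin n → ℝ) ×
          (Fin (n * (n - 1) / 2) → ℝ) => F (d ⬝ᵥ d + (q.1 ⬝ᵥ q.1 + q.2 ⬝ᵥ q.2))) ?_
        exact (hF' _).comp (((hdot _).comp measurable_fst).add ((hdot _).comp measurable_snd))
    have hV : ENNReal.ofReal (absVandermonde (n + 1) d)⁻¹ =
        ENNReal.ofReal (∏ i : Fin n, |d i.succ - d 0|)⁻¹ *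
          ENNReal.ofReal (absVandermonde n (Fin.tail d))⁻¹ := by
      rw [absVandermonde, mul_inv, ENNReal.ofReal_mul]
      exact inv_nonneg.2 (Finset.prod_nonneg fun _ _ => abs_nonneg _)
    have hconst : ∀ v : Fin (n + 1) → ℝ, ∫⁻ A : Matrix (Fin n) (Fin n) ℝ,
        {v : Fin (n + 1) → ℝ | 1 ≤ v ⬝ᵥ v ∧ v ⬝ᵥ v < 4}.indicator
          (fun v => ENNReal.ofReal (√(v ⬝ᵥ v) ^ (n + 1))⁻¹) v *
        (ENNReal.ofReal (∏ i : Fin n, |d i.succ - d 0|)⁻¹ *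
        ∫⁻ c : Fin n → ℝ, (pivotSet n).indicator (fun A => ENNReal.ofReal (|A.det| ^ n)⁻¹ *
          F (d 0 ^ 2 + c ⬝ᵥ c + conjNormSq (Fin.tail d) A)) A) =
        {v : Fin (n + 1) → ℝ | 1 ≤ v ⬝ᵥ v ∧ v ⬝ᵥ v < 4}.indicator
          (fun v => ENNReal.ofReal (√(v ⬝ᵥ v) ^ (n + 1))⁻¹) v *
        (ENNReal.ofReal (∏ i : Fin n, |d i.succ - d 0|)⁻¹ *
        ((∏ i ∈ Finset.range n, shellVolume (i + 1)) *
          ENNReal.ofReal (absVandermonde n (Fin.tail d))⁻¹ *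
          ∫⁻ c : Fin ((n + 1) * (n + 1 - 1) / 2) → ℝ, F (d ⬝ᵥ d + c ⬝ᵥ c))) := by
      intro v
      rw [← hswap, lintegral_const_mul _ (hin.const_mul _), lintegral_const_mul _ hin]
    rw [lintegral_congr hconst, lintegral_mul_const _ hshell, Finset.prod_range_succ, hV,
      ← shellVolume]
    ring

/-! ### Shell volumes and the constant -/

/-- In polar coordinates the radial integrand is r^m · r^(-(m+1)) = 1/r, so the shell has volume
(m+1) · vol(unit ball) · log 2. -/
theorem shellVolume_succ (m : ℕ) :
    shellVolume (m + 1) =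
      annC * ENNReal.ofReal (√Real.pi ^ (m + 1) / Real.Gamma (((m + 1 : ℕ) : ℝ) / 2)) := by
  set E := EuclideanSpace ℝ (Fin (m + 1))
  set g : ℝ → ℝ := (Set.Ico 1 2).indicator fun r => (r ^ (m + 1))⁻¹ with hg
  have hnorm : ∀ w : E, w.ofLp ⬝ᵥ w.ofLp = ‖w‖ ^ 2 := by
    intro w
    rw [EuclideanSpace.norm_sq_eq]
    simp [dotProduct, sq]
  have hker : ∀ y ∈ Set.Ioi (0 : ℝ), y ^ (Module.finrank ℝ E - 1) • g y =
      (Set.Ico 1 2).indicator (fun r => r⁻¹) y := by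
    intro y hy
    have hy : 0 < y := hy
    simp only [hg, E, finrank_euclideanSpace, Fintype.card_fin, Nat.add_sub_cancel, smul_eq_mul]
    by_cases h : y ∈ Set.Ico 1 2
    · rw [Set.indicator_of_mem h, Set.indicator_of_mem h]
      field_simp
      ring
    · rw [Set.indicator_of_notMem h, Set.indicator_of_notMem h, mul_zero]
  have hsub : Set.Ioi (0 : ℝ) ∩ Set.Ico 1 2 = Set.Ico 1 2 :=
    Set.inter_eq_right.2 fun y hy => one_pos.trans_le hy.1
  have hint : IntegrableOn (fun r : ℝ => r⁻¹) (Set.Ico 1 2) := by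
    refine (ContinuousOn.integrableOn_Icc (f := fun r : ℝ => r⁻¹) (a := 1) (b := 2)
      (continuousOn_id.inv₀ fun y hy => ?_)).mono_set Set.Ico_subset_Icc_self
    exact (one_pos.trans_le hy.1).ne'
  have hgi : Integrable (fun w : E => g ‖w‖) := by
    rw [integrable_fun_norm_addHaar, integrableOn_congr_fun hker measurableSet_Ioi]
    exact (hint.integrable_indicator measurableSet_Ico).integrableOn
  have hg0 : ∀ r : ℝ, 0 ≤ g r := fun r => Set.indicator_nonneg
    (fun y hy => inv_nonneg.2 (pow_nonneg (zero_le_one.trans hy.1) _)) r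
  have hI : ∫ w : E, g ‖w‖ = (m + 1) * ((volume : Measure E).real (Metric.ball 0 1) *
      Real.log 2) := by
    rw [integral_fun_norm_addHaar, setIntegral_congr_fun measurableSet_Ioi hker,
      setIntegral_indicator measurableSet_Ico, hsub, integral_Ico_eq_integral_Ioc,
      ← intervalIntegral.integral_of_le one_le_two, integral_inv_of_pos one_pos two_pos]
    simp [E]
  have hvol : (volume : Measure E).real (Metric.ball 0 1) =
      √Real.pi ^ (m + 1) / Real.Gamma (((m + 1 : ℕ) : ℝ) / 2 + 1) := by
    rw [Measure.real, EuclideanSpace.volume_ball, ENNReal.ofReal_one, one_pow, one_mul,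
      ENNReal.toReal_ofReal, Fintype.card_fin]
    rw [Fintype.card_fin]
    have := Real.Gamma_pos_of_pos (s := ((m + 1 : ℕ) : ℝ) / 2 + 1) (by positivity)
    positivity
  have h1 : shellVolume (m + 1) = ∫⁻ w : E, ENNReal.ofReal (g ‖w‖) := by
    rw [shellVolume, ← (PiLp.volume_preserving_ofLp (Fin (m + 1))).lintegral_comp_emb
      (MeasurableEquiv.toLp 2 (Fin (m + 1) → ℝ)).symm.measurableEmbedding]
    refine lintegral_congr fun w => ?_
    have hm : w.ofLp ∈ {v : Fin (m + 1) → ℝ | 1 ≤ v ⬝ᵥ v ∧ v ⬝ᵥ v < 4} ↔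
        ‖w‖ ∈ Set.Ico (1 : ℝ) 2 := by
      have h0 := norm_nonneg w
      simp only [Set.mem_ofPred_eq, Set.mem_Ico, hnorm]
      refine and_congr ⟨fun h => ?_, fun h => ?_⟩ ⟨fun h => ?_, fun h => ?_⟩ <;> nlinarith
    by_cases h : ‖w‖ ∈ Set.Ico (1 : ℝ) 2
    · rw [Set.indicator_of_mem (hm.2 h), hg, Set.indicator_of_mem h, hnorm,
        Real.sqrt_sq (norm_nonneg w)]
    · rw [Set.indicator_of_notMem fun h' => h (hm.1 h'), hg, Set.indicator_of_notMem h,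
        ENNReal.ofReal_zero]
  have hG := Real.Gamma_pos_of_pos (s := ((m + 1 : ℕ) : ℝ) / 2) (by positivity)
  have hlog := Real.log_pos one_lt_two
  have hann : annC = ENNReal.ofReal (2 * Real.log 2) := by
    rw [annC, ENNReal.ofReal_mul two_pos.le, ENNReal.ofReal_ofNat]
  -- Since Γ(s + 1) = s Γ(s) at s = (m+1)/2, the factor m + 1 becomes 2, which together with log 2
  -- makes up `annC`.
  rw [h1, ← ofReal_integral_eq_lintegral_ofReal hgi (ae_of_all _ fun w => hg0 _), hI, hvol, hann,
    ← ENNReal.ofReal_mul (by positivity), Real.Gamma_add_one (by positivity)]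
  congr 1
  push_cast
  field_simp

/-- The product of the shell volumes, with the constant `π^(n(n+1)/4) / ∏ Γ(i/2)`. -/
theorem prod_shellVolume (n : ℕ) :
    ∏ i ∈ Finset.range n, shellVolume (i + 1) = annC ^ n *
      ENNReal.ofReal (Real.pi ^ ((n : ℝ) * (n + 1) / 4) /
        ∏ i ∈ Finset.Icc 1 n, Real.Gamma ((i : ℝ) / 2)) := by
  induction n with
  | zero => simp
  | succ n ih =>
    have hG : ∀ i ∈ Finset.Icc 1 n, 0 < Real.Gamma ((i : ℝ) / 2) := fun i hi =>
      Real.Gamma_pos_of_pos (by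
        have : 0 < (i : ℝ) := by exact_mod_cast (Finset.mem_Icc.1 hi).1
        positivity)
    have hP := Finset.prod_pos hG
    have hπ := Real.pi_pos
    have hpow : Real.pi ^ (((n + 1 : ℕ) : ℝ) * ((n + 1 : ℕ) + 1) / 4) =
        Real.pi ^ ((n : ℝ) * (n + 1) / 4) * √Real.pi ^ (n + 1) := by
      rw [Real.sqrt_eq_rpow, ← Real.rpow_natCast, ← Real.rpow_mul hπ.le, ← Real.rpow_add hπ]
      congr 1
      push_cast
      ring
    rw [Finset.prod_range_succ, ih, shellVolume_succ, Finset.prod_Icc_succ_top (by lia), hpow,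
      mul_div_mul_comm, ENNReal.ofReal_mul (by positivity), pow_succ]
    ring

theorem volume_dotProduct_le {m : ℕ} {R : ℝ} (hR : 0 ≤ R) :
    volume {c : Fin m → ℝ | c ⬝ᵥ c ≤ R ^ 2} = ENNReal.ofReal (R ^ m) *
      volume (Metric.ball (0 : EuclideanSpace ℝ (Fin m)) 1) := by
  have h := Measure.addHaar_closedBall (volume : Measure (EuclideanSpace ℝ (Fin m))) 0 hR
  rw [finrank_euclideanSpace, Fintype.card_fin] at h
  rw [← h, ← (PiLp.volume_preserving_ofLp (Fin m)).measure_preimage_emb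
    (MeasurableEquiv.toLp 2 (Fin m → ℝ)).symm.measurableEmbedding]
  congr 1
  ext w
  have : w.ofLp ⬝ᵥ w.ofLp = ‖w‖ ^ 2 := by
    rw [EuclideanSpace.norm_sq_eq]
    simp [dotProduct, sq]
  simp only [Set.mem_preimage, Set.mem_ofPred_eq, this, Metric.mem_closedBall, dist_zero_right]
  exact sq_le_sq₀ (norm_nonneg w) hR

/-! ### Diagonalization and the discriminant -/

/-- Simultaneous diagonalization of a matrix with simple real eigenvalues and of its torus. -/
theorem exists_diagonalization {n : ℕ} {p : ℝ[X]} (x : CharpolyFiber n p) (hs : p.Splits)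
    (hn : p.roots.Nodup) :
    ∃ (ρ : Fin n ≃ p.roots.toFinset) (a : GL (Fin n) ℝ),
      a.1 * x.1 = Matrix.diagonal (fun i => (ρ i).1) * a.1 ∧
      ∀ t, a.1 * x.torusParam t = Matrix.diagonal (fun i => t (ρ i)) * a.1 := by
  have hcard : Fintype.card p.roots.toFinset = n := by
    rw [Fintype.card_coe, Multiset.toFinset_card_of_nodup hn, ← hs.natDegree_eq_card_roots, ← x.2,
      Matrix.charpoly_natDegree_eq_dim, Fintype.card_fin]
  obtain ρ : Fin n ≃ p.roots.toFinset := (Fintype.equivFinOfCardEq hcard).symm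
  -- The rows of a are left eigenvectors of x, that is, eigenvectors of its transpose.
  have hev : ∀ i, ∃ u : Fin n → ℝ, Module.End.HasEigenvector (Matrix.toLin' x.1ᵀ) (ρ i).1 u := by
    intro i
    refine Module.End.HasEigenvalue.exists_hasEigenvector ?_
    rw [Module.End.hasEigenvalue_iff_isRoot_charpoly, Matrix.charpoly_toLin',
      Matrix.charpoly_transpose, x.2]
    exact isRoot_of_mem_roots (Multiset.mem_toFinset.1 (ρ i).2)
  choose u hu using hev
  have hli : LinearIndependent ℝ u :=
    Module.End.eigenvectors_linearIndependent' _ (fun i => (ρ i).1)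
      (Subtype.val_injective.comp ρ.injective) u hu
  have hunit : IsUnit (Matrix.of u) := Matrix.linearIndependent_rows_iff_isUnit.1 hli
  obtain ⟨a, ha⟩ := hunit
  have hax : a.1 * x.1 = Matrix.diagonal (fun i => (ρ i).1) * a.1 := by
    rw [ha]
    ext i j
    have := congrFun (hu i).apply_eq_smul j
    rw [Matrix.toLin'_apply, Matrix.mulVec_transpose] at this
    rw [Matrix.diagonal_mul]
    exact this
  refine ⟨ρ, a, hax, fun t => ?_⟩
  have key : ∀ q : ℝ[X], a.1 * aeval x.1 q =
      Matrix.diagonal (fun i => q.eval (ρ i).1) * a.1 := by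
    intro q
    induction q using Polynomial.induction_on' with
    | add f g hf hg => simp only [map_add, mul_add, hf, hg, eval_add, ← Matrix.diagonal_add, add_mul]
    | monomial k c =>
      have hk : a.1 * x.1 ^ k = Matrix.diagonal (fun i => (ρ i).1) ^ k * a.1 :=
        SemiconjBy.pow_right (show SemiconjBy a.1 x.1 _ from hax) k
      rw [aeval_monomial, ← Algebra.smul_def, Matrix.mul_smul, hk, Matrix.diagonal_pow]
      ext i j
      simp [Matrix.diagonal_mul, mul_assoc]
  rw [torusParam_eq, key]
  simp only [interp_eval]

/-- Up to sign the discriminant of a monic p is the resultant of p and p', which is the product of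
p'(d_i) = ∏_{j ≠ i} (d_i - d_j). -/
theorem sq_absVandermonde_eq_abs_discr {n : ℕ} {p : ℝ[X]} (hm : p.Monic) (hs : p.Splits)
    (hn : p.roots.Nodup) (hd : 0 < p.natDegree) (ρ : Fin n ≃ p.roots.toFinset) :
    absVandermonde n (fun i => (ρ i).1) ^ 2 = |p.discr| := by
  classical
  set d : Fin n → ℝ := fun i => (ρ i).1 with hd'
  have hinj : Function.Injective d := Subtype.val_injective.comp ρ.injective
  have hroots : p.roots = Finset.univ.val.map d := by
    refine (Multiset.Nodup.ext hn ((Multiset.nodup_map_iff_of_injective hinj).2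
      Finset.univ.nodup)).2 fun r => ?_
    simp only [Multiset.mem_map, Finset.mem_val, Finset.mem_univ, true_and]
    refine ⟨fun hr => ⟨ρ.symm ⟨r, Multiset.mem_toFinset.2 hr⟩, by simp [hd']⟩, ?_⟩
    rintro ⟨i, rfl⟩
    exact Multiset.mem_toFinset.1 (ρ i).2
  have h1 := resultant_deriv (natDegree_pos_iff_degree_pos.1 hd)
  rw [resultant_eq_prod_eval p _ _ (natDegree_derivative_le p) hs, hm.leadingCoeff, one_pow,
    one_mul, mul_one] at h1
  have h2 := congrArg abs h1
  rw [abs_mul, abs_pow, abs_neg, abs_one, one_pow, one_mul] at h2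
  rw [← h2, absVandermonde_sq, hroots, Multiset.map_map, ← Finset.prod_eq_multiset_prod,
    Finset.abs_prod]
  refine Finset.prod_congr rfl fun i _ => ?_
  have hi : d i ∈ p.roots := Multiset.mem_toFinset.1 (ρ i).2
  rw [Function.comp_apply, hs.eval_root_derivative hm hi, hroots, ← Multiset.map_erase _ hinj,
    Multiset.map_map, ← Finset.erase_val, ← Finset.prod_eq_multiset_prod, Finset.abs_prod]
  rfl

/-- Monicity keeps the degree under f, so the resultant of p and p' is compatible with f; the sign
relating it to the discriminant is a unit and cancels. -/
theorem map_discr_of_monic {R S : Type*} [CommRing R] [CommRing S] [Nontrivial S] (f : R →+* S)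
    {p : R[X]} (hm : p.Monic) (hd : 0 < p.natDegree) : (p.map f).discr = f p.discr := by
  have hR : Nontrivial R := f.domain_nontrivial
  have hdeg : (p.map f).natDegree = p.natDegree := hm.natDegree_map f
  have h1 := resultant_deriv (natDegree_pos_iff_degree_pos.1 hd)
  have h2 := resultant_deriv (natDegree_pos_iff_degree_pos.1 (hdeg.symm ▸ hd))
  rw [hdeg, derivative_map, resultant_map_map, h1, hm.leadingCoeff, (hm.map f).leadingCoeff,
    map_mul, map_mul, map_pow, map_neg, map_one, mul_one] at h2
  have hu : IsUnit ((-1 : S) ^ (p.natDegree * (p.natDegree - 1) / 2)) :=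
    (isUnit_one.neg).pow _
  exact (hu.mul_left_cancel (by simpa using h2)).symm

/-! ### The exact volume of a ball in a real fibre -/

theorem measurableSet_normBall (n : ℕ) (p : ℝ[X]) (T : ℝ) : MeasurableSet (normBall n p T) := by
  refine measurableSet_le (f := fun x : CharpolyFiber n p => √(∑ i, ∑ j, |x.1 i j| ^ 2)) ?_
    measurable_const
  have h : Measurable fun A : Matrix (Fin n) (Fin n) ℝ => √(∑ i, ∑ j, |A i j| ^ 2) := by
    refine Continuous.measurable ?_
    fun_prop
  exact h.comp measurable_subtype_coe

theorem mem_normBall {n : ℕ} {p : ℝ[X]} {T : ℝ} (hT : 0 ≤ T) (x : CharpolyFiber n p) :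
    x ∈ normBall n p T ↔ ∑ i, ∑ j, x.1 i j ^ 2 ≤ T ^ 2 := by
  simp only [normBall, Set.mem_ofPred_eq, Real.sqrt_le_iff, hT, true_and, sq_abs]

/-- The volume of the torus parameters moving a given invertible matrix into the pivot set. -/
theorem pi_pivotSet {n : ℕ} {p : ℝ[X]} (ρ : Fin n ≃ p.roots.toFinset)
    {A : Matrix (Fin n) (Fin n) ℝ} (hA : A.det ≠ 0) :
    Measure.pi (fun _ : p.roots.toFinset => multHaar)
      {t | ∀ i, 1 ≤ t (ρ i) ^ 2 * pivots n (A * Aᵀ) i ∧ t (ρ i) ^ 2 * pivots n (A * Aᵀ) i < 4} =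
      totC p := by
  have h : {t : p.roots.toFinset → ℝ | ∀ i, 1 ≤ t (ρ i) ^ 2 * pivots n (A * Aᵀ) i ∧
      t (ρ i) ^ 2 * pivots n (A * Aᵀ) i < 4} = Set.univ.pi fun r => {s |
        1 ≤ |s| * √(pivots n (A * Aᵀ) (ρ.symm r)) ∧
        |s| * √(pivots n (A * Aᵀ) (ρ.symm r)) < 2} := by
    ext t
    simp only [Set.mem_ofPred_eq, Set.mem_univ_pi]
    refine ρ.forall_congr fun i => ?_
    rw [ρ.symm_apply_apply]
    have hp := pivots_gram_pos hA i
    have h0 : 0 ≤ |t (ρ i)| * √(pivots n (A * Aᵀ) i) := by positivity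
    have hsq : t (ρ i) ^ 2 * pivots n (A * Aᵀ) i =
        (|t (ρ i)| * √(pivots n (A * Aᵀ) i)) ^ 2 := by
      rw [mul_pow, sq_abs, Real.sq_sqrt hp.le]
    rw [hsq]
    refine and_congr ⟨fun h => ?_, fun h => ?_⟩ ⟨fun h => ?_, fun h => ?_⟩ <;> nlinarith
  rw [h, Measure.pi_pi]
  exact Finset.prod_congr rfl fun r _ => multHaar_ann1 (Real.sqrt_pos.2 (pivots_gram_pos hA _))

/-- The density itself vanishes on singular matrices, by 0⁻¹ = 0, so their Lebesgue measure plays no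
role. -/
theorem ae_det_ne_zero (n : ℕ) : ∀ᵐ A ∂matrixHaar n, A.det ≠ 0 := by
  have h := measurable_det (n := n)
  rw [matrixHaar, ae_withDensity_iff (by fun_prop)]
  refine ae_of_all _ fun A hA hdet => ?_
  have hn : n ≠ 0 := by
    rintro rfl
    simp at hdet
  simp [hdet, hn] at hA

/-- The defining property of the quotient measure is tested on the indicator of the g in the
preimage of the ball with a g in `pivotSet`. Its torus integral is the constant `totC` over the ball
and 0 elsewhere. -/
theorem canMeasure_normBall {n : ℕ} {p : ℝ[X]} (x : CharpolyFiber n p) (hs : p.Splits)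
    (hn : p.roots.Nodup) :
    ∃ ρ : Fin n ≃ p.roots.toFinset, ∀ T : ℝ, 0 ≤ T → x.canMeasure (normBall n p T) =
      ENNReal.ofReal (Real.pi ^ ((n : ℝ) * (n + 1) / 4) /
        ∏ i ∈ Finset.Icc 1 n, Real.Gamma ((i : ℝ) / 2)) *
      ENNReal.ofReal (absVandermonde n fun i => (ρ i).1)⁻¹ *
      volume {c : Fin (n * (n - 1) / 2) → ℝ | ∑ i, (ρ i).1 ^ 2 + c ⬝ᵥ c ≤ T ^ 2} := by
  obtain ⟨ρ, a, hax, hat⟩ := exists_diagonalization x hs hn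
  refine ⟨ρ, fun T hT => ?_⟩
  set d : Fin n → ℝ := fun i => (ρ i).1 with hd
  have hinj : Function.Injective d := Subtype.val_injective.comp ρ.injective
  set B := normBall n p T with hB
  have hBm : MeasurableSet B := measurableSet_normBall n p T
  set F : ℝ → ℝ≥0∞ := (Set.Iic (T ^ 2)).indicator 1 with hF
  have hFm : Measurable F := measurable_one.indicator measurableSet_Iic
  have hval := (measurableEmbedding_val (n := n)).measurable
  have hdet : ∀ g : GL (Fin n) ℝ, g.1.det ≠ 0 := fun g =>
    ((Matrix.isUnit_iff_isUnit_det _).1 g.isUnit).ne_zero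
  have hconj : ∀ g : GL (Fin n) ℝ, x.orbit g ∈ B ↔ conjNormSq d (a.1 * g.1) ≤ T ^ 2 := by
    intro g
    have : (a.1 * g.1)⁻¹ * Matrix.diagonal d * (a.1 * g.1) = (x.orbit g).1 := by
      rw [← Units.val_mul, ← Matrix.coe_units_inv, mul_inv_rev, Units.val_mul, Units.val_mul]
      calc _ = (g⁻¹).1 * ((a⁻¹).1 * (Matrix.diagonal d * a.1)) * g.1 := by simp only [mul_assoc]
        _ = _ := by rw [← hax, Units.inv_mul_cancel_left]; rfl
    rw [hB, mem_normBall hT, conjNormSq, this]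
  set S : Set (GL (Fin n) ℝ) := {g | a.1 * g.1 ∈ pivotSet n} with hS
  have hmul : Measurable fun A : Matrix (Fin n) (Fin n) ℝ => a.1 * A :=
    measurable_mat_mul.comp (measurable_const.prodMk measurable_id)
  have hSm : MeasurableSet S := (hmul.comp hval) (measurableSet_pivotSet n)
  have hSB : MeasurableSet (S ∩ x.orbit ⁻¹' B) := hSm.inter (measurable_orbit x hBm)
  have hfm : Measurable ((S ∩ x.orbit ⁻¹' B).indicator (1 : GL (Fin n) ℝ → ℝ≥0∞)) :=
    measurable_one.indicator hSB
  have htorus : ∀ g, B.indicator (fun _ => totC p) (x.orbit g) =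
      ∫⁻ t, (S ∩ x.orbit ⁻¹' B).indicator 1 (t * g) ∂x.torusHaar := by
    intro g
    have hu : (a.1 * g.1).det ≠ 0 := by
      rw [Matrix.det_mul]
      exact mul_ne_zero (hdet a) (hdet g)
    -- Since a t g = diag(t) a g, passing from g to t g conjugates the Gram matrix of a g by diag(t)
    -- and scales its pivots by t_i².
    have hmem : ∀ t (ht : ∀ r, t r ≠ 0), torusUnit x hs hn t ht * g ∈ S ↔
        ∀ i, 1 ≤ t (ρ i) ^ 2 * pivots n (a.1 * g.1 * (a.1 * g.1)ᵀ) i ∧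
          t (ρ i) ^ 2 * pivots n (a.1 * g.1 * (a.1 * g.1)ᵀ) i < 4 := by
      intro t ht
      have h1 : a.1 * (torusUnit x hs hn t ht * g).1 =
          Matrix.diagonal (fun i => t (ρ i)) * (a.1 * g.1) := by
        change a.1 * (x.torusParam t * g.1) = _
        rw [← mul_assoc, hat, mul_assoc]
      have h2 : a.1 * (torusUnit x hs hn t ht * g).1 *
          (a.1 * (torusUnit x hs hn t ht * g).1)ᵀ = Matrix.diagonal (fun i => t (ρ i)) *
            (a.1 * g.1 * (a.1 * g.1)ᵀ) * Matrix.diagonal (fun i => t (ρ i)) := by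
        rw [h1, Matrix.transpose_mul, Matrix.diagonal_transpose]
        simp only [mul_assoc]
      simp only [hS, pivotSet, Set.mem_ofPred_eq, h2,
        pivots_diagonal_conj (t := fun i => t (ρ i)) fun i => ht (ρ i)]
    rw [torus_lintegral x hfm]
    by_cases hg : x.orbit g ∈ B
    · have hset : MeasurableSet {t : p.roots.toFinset → ℝ | ∀ i,
          1 ≤ t (ρ i) ^ 2 * pivots n (a.1 * g.1 * (a.1 * g.1)ᵀ) i ∧
          t (ρ i) ^ 2 * pivots n (a.1 * g.1 * (a.1 * g.1)ᵀ) i < 4} := by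
        simp only [Set.ofPred_forall]
        refine MeasurableSet.iInter fun i => ?_
        have : Measurable fun t : p.roots.toFinset → ℝ =>
            t (ρ i) ^ 2 * pivots n (a.1 * g.1 * (a.1 * g.1)ᵀ) i := by fun_prop
        exact (measurableSet_le measurable_const this).inter
          (measurableSet_lt this measurable_const)
      rw [Set.indicator_of_mem hg, ← pi_pivotSet ρ hu, ← lintegral_indicator_one hset]
      refine lintegral_congr_ae ?_
      filter_upwards [ae_ne_zero p] with t ht
      have h1 : x.torusParam t * g.1 = (torusUnit x hs hn t ht * g).1 := rfl
      have h2 : x.orbit (torusUnit x hs hn t ht * g) = x.orbit g :=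
        orbit_torusUnit x _ g (torusParam_comm x t)
      rw [h1, ext0_val]
      refine Set.indicator_eq_indicator ?_ rfl
      simp only [Set.mem_inter_iff, Set.mem_preimage, h2, hg, and_true]
      exact (hmem t ht).symm
    · rw [Set.indicator_of_notMem hg]
      refine (lintegral_zero.symm.trans (lintegral_congr_ae ?_))
      filter_upwards [ae_ne_zero p] with t ht
      have h1 : x.torusParam t * g.1 = (torusUnit x hs hn t ht * g).1 := rfl
      have h2 : x.orbit (torusUnit x hs hn t ht * g) = x.orbit g :=
        orbit_torusUnit x _ g (torusParam_comm x t)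
      rw [h1, ext0_val, Set.indicator_of_notMem]
      rintro ⟨-, hh⟩
      exact hg (h2 ▸ hh)
  have hq := isQuotientMeasure_canMeasure x hs hn _ _ hfm (measurable_const.indicator hBm) htorus
  rw [lintegral_indicator_const hBm, glHaar, lintegral_comap_val] at hq
  set w : Matrix (Fin n) (Fin n) ℝ → ℝ≥0∞ :=
    (pivotSet n).indicator fun A => F (conjNormSq d A) with hw
  have hwm : Measurable w := (hFm.comp (measurable_conjNormSq d)).indicator
    (measurableSet_pivotSet n)
  have hae : ∫⁻ A, ext0 ((S ∩ x.orbit ⁻¹' B).indicator 1) A ∂matrixHaar n =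
      ∫⁻ A, w (a.1 * A) ∂matrixHaar n := by
    refine lintegral_congr_ae ?_
    filter_upwards [ae_det_ne_zero n] with A hA
    obtain ⟨g, rfl⟩ := (Matrix.isUnit_iff_isUnit_det A).2 (isUnit_iff_ne_zero.2 hA)
    rw [ext0_val, hw]
    by_cases hg : a.1 * g.1 ∈ pivotSet n
    · rw [Set.indicator_of_mem hg, hF]
      refine Set.indicator_eq_indicator ?_ rfl
      rw [Set.mem_Iic, ← hconj]
      exact and_iff_right hg
    · rw [Set.indicator_of_notMem hg, Set.indicator_of_notMem fun h => hg h.1]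
  have hden : ∫⁻ A, w A ∂matrixHaar n = ∫⁻ A, (pivotSet n).indicator
      (fun A => ENNReal.ofReal (|A.det| ^ n)⁻¹ * F (conjNormSq d A)) A := by
    have := measurable_det (n := n)
    rw [matrixHaar, lintegral_withDensity_eq_lintegral_mul volume (by fun_prop) hwm]
    refine lintegral_congr fun A => ?_
    rw [Pi.mul_apply, hw]
    by_cases hA : A ∈ pivotSet n
    · simp only [Set.indicator_of_mem hA]
    · simp only [Set.indicator_of_notMem hA, mul_zero]
  have htot : totC p = annC ^ n := by
    rw [totC, Finset.prod_const, Finset.card_univ, ← Fintype.card_congr ρ, Fintype.card_fin]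
  have hvol : ∫⁻ c : Fin (n * (n - 1) / 2) → ℝ, F (d ⬝ᵥ d + c ⬝ᵥ c) =
      volume {c : Fin (n * (n - 1) / 2) → ℝ | ∑ i, (ρ i).1 ^ 2 + c ⬝ᵥ c ≤ T ^ 2} := by
    have hdot : Measurable fun c : Fin (n * (n - 1) / 2) → ℝ => ∑ i, (ρ i).1 ^ 2 + c ⬝ᵥ c :=
      measurable_const.add (Continuous.dotProduct continuous_id continuous_id).measurable
    rw [← lintegral_indicator_one (measurableSet_le hdot measurable_const)]
    refine lintegral_congr fun c => ?_
    have : d ⬝ᵥ d = ∑ i, (ρ i).1 ^ 2 := by simp [dotProduct, hd, sq]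
    rw [this]
    rfl
  -- Invariance removes a; then `annC` ^ n from the shell volumes equals `totC` p and cancels
  -- against the torus volume.
  rw [hae, lmul_matrixHaar a w hwm, hden, lintegral_pivotSet_conjNormSq n hinj hFm,
    prod_shellVolume, hvol, ← htot, mul_assoc (totC p), mul_assoc (totC p)] at hq
  exact ((ENNReal.mul_right_inj totC_ne_zero totC_ne_top).1 hq).symm

/-! ### Finiteness and asymptotics at one place -/

theorem absVandermonde_pos {n : ℕ} {d : Fin n → ℝ} (hd : Function.Injective d) :
    0 < absVandermonde n d := by
  induction n with
  | zero => exact zero_lt_one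
  | succ n ih =>
    refine mul_pos (Finset.prod_pos fun i _ => ?_) (ih (hd.comp (Fin.succ_injective n)))
    exact abs_pos.2 (sub_ne_zero.2 fun h => Fin.succ_ne_zero i (hd h))

theorem volume_shifted_ball {m : ℕ} {s T : ℝ} (h : s ≤ T ^ 2) :
    volume {c : Fin m → ℝ | s + c ⬝ᵥ c ≤ T ^ 2} = ENNReal.ofReal (√(T ^ 2 - s) ^ m) *
      volume (Metric.ball (0 : EuclideanSpace ℝ (Fin m)) 1) := by
  rw [← volume_dotProduct_le (Real.sqrt_nonneg _), Real.sq_sqrt (sub_nonneg.2 h)]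
  congr 1
  ext c
  simp only [Set.mem_ofPred_eq, le_sub_iff_add_le']

theorem canMeasure_normBall_lt_top {n : ℕ} {p : ℝ[X]} (x : CharpolyFiber n p) (hs : p.Splits)
    (hn : p.roots.Nodup) (T : ℝ) : x.canMeasure (normBall n p T) < ∞ := by
  obtain ⟨ρ, hρ⟩ := canMeasure_normBall x hs hn
  -- The volume formula needs a nonnegative radius, hence the passage to |T|.
  have hsub : normBall n p T ⊆ normBall n p |T| := fun y hy => le_trans hy (le_abs_self T)
  refine (measure_mono hsub).trans_lt ?_
  rw [hρ _ (abs_nonneg T)]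
  refine ENNReal.mul_lt_top (ENNReal.mul_lt_top ENNReal.ofReal_lt_top ENNReal.ofReal_lt_top) ?_
  have hsub' : {c : Fin (n * (n - 1) / 2) → ℝ | ∑ i, (ρ i).1 ^ 2 + c ⬝ᵥ c ≤ |T| ^ 2} ⊆
      {c | c ⬝ᵥ c ≤ |T| ^ 2} := by
    intro c hc
    have h0 : 0 ≤ ∑ i, (ρ i).1 ^ 2 := Finset.sum_nonneg fun i _ => sq_nonneg _
    exact (le_add_of_nonneg_left h0).trans hc
  refine (measure_mono hsub').trans_lt ?_
  rw [volume_dotProduct_le (abs_nonneg T)]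
  exact ENNReal.mul_lt_top ENNReal.ofReal_lt_top measure_ball_lt_top

theorem prod_Gamma_pos (n : ℕ) : 0 < ∏ i ∈ Finset.Icc 1 n, Real.Gamma ((i : ℝ) / 2) :=
  Finset.prod_pos fun i hi => Real.Gamma_pos_of_pos (by
    have : 0 < (i : ℝ) := by exact_mod_cast (Finset.mem_Icc.1 hi).1
    positivity)

theorem unitBallVolume_pos (n : ℕ) : 0 < unitBallVolume n :=
  ENNReal.toReal_pos (Metric.measure_ball_pos _ _ one_pos).ne' measure_ball_lt_top.ne

theorem tendsto_sqrt_sq_sub_div (s : ℝ) :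
    Tendsto (fun T : ℝ => √(T ^ 2 - s) / T) atTop (𝓝 1) := by
  have h : Tendsto (fun T : ℝ => √(1 - s / T ^ 2)) atTop (𝓝 √(1 - 0)) :=
    (tendsto_const_nhds.sub
      (tendsto_const_nhds.div_atTop (tendsto_pow_atTop two_ne_zero))).sqrt
  rw [sub_zero, Real.sqrt_one] at h
  refine h.congr' ?_
  filter_upwards [eventually_gt_atTop 0] with T hT
  rw [eq_div_iff hT.ne']
  nth_rw 2 [← Real.sqrt_sq hT.le]
  rw [← Real.sqrt_mul' _ (sq_nonneg T)]
  congr 1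
  field_simp

/-- For large T the quotient equals (√(T² - s) / T)^(n(n-1)/2) exactly, where s is the sum of the
squares of the roots. -/
theorem tendsto_canMeasure_normBall {n : ℕ} {p : ℝ[X]} (x : CharpolyFiber n p) (hm : p.Monic)
    (hs : p.Splits) (hn : p.roots.Nodup) (hd : 0 < p.natDegree) :
    Tendsto (fun T : ℝ => (x.canMeasure (normBall n p T)).toReal /
      ((unitBallVolume n * Real.pi ^ ((n : ℝ) * (n + 1) / 4) /
        (∏ i ∈ Finset.Icc 1 n, Real.Gamma ((i : ℝ) / 2)) * T ^ (n * (n - 1) / 2)) *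
        |p.discr| ^ (-(1 / 2) : ℝ))) atTop (𝓝 1) := by
  obtain ⟨ρ, hρ⟩ := canMeasure_normBall x hs hn
  have hV := absVandermonde_pos (d := fun i => (ρ i).1)
    (Subtype.val_injective.comp ρ.injective)
  have hdisc : |p.discr| ^ (-(1 / 2) : ℝ) = (absVandermonde n fun i => (ρ i).1)⁻¹ := by
    rw [← sq_absVandermonde_eq_abs_discr hm hs hn hd ρ, Real.rpow_neg (by positivity),
      ← Real.sqrt_eq_rpow, Real.sqrt_sq hV.le]
  have h := (tendsto_sqrt_sq_sub_div (∑ i, (ρ i).1 ^ 2)).pow (n * (n - 1) / 2)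
  rw [one_pow] at h
  refine h.congr' ?_
  have hlarge : ∀ᶠ T : ℝ in atTop, ∑ i, (ρ i).1 ^ 2 ≤ T ^ 2 :=
    (tendsto_pow_atTop two_ne_zero).eventually_ge_atTop _
  filter_upwards [eventually_gt_atTop 0, hlarge] with T hT hTs
  have hG := prod_Gamma_pos n
  have hw := unitBallVolume_pos n
  have hπ := Real.pi_pos
  rw [hρ T hT.le, volume_shifted_ball hTs, hdisc, ENNReal.toReal_mul, ENNReal.toReal_mul,
    ENNReal.toReal_mul, ENNReal.toReal_ofReal (by positivity),
    ENNReal.toReal_ofReal (by positivity), ENNReal.toReal_ofReal (by positivity),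
    ← unitBallVolume, div_pow]
  field_simp

/-! ### Archimedean places of a totally real field -/

section NumberField

variable {k : Type*} [Field k] [IsTotallyReal k]

theorem coe_realEmb (v : InfinitePlace k) (a : 𝓞 k) :
    ((realEmb k v a : ℝ) : ℂ) = v.embedding (algebraMap (𝓞 k) k a) :=
  InfinitePlace.embedding_of_isReal_apply (IsTotallyReal.isReal v) _

theorem abs_realEmb (v : InfinitePlace k) (a : 𝓞 k) :
    |realEmb k v a| = v (algebraMap (𝓞 k) k a) :=
  InfinitePlace.norm_embedding_of_isReal (IsTotallyReal.isReal v) _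

/-- A complex root z of χ at v defines an embedding of K into ℂ extending v and sending the class of
the variable to z. As K is totally real, the image is real, so z is real. -/
theorem map_realEmb_splits {χ : (𝓞 k)[X]} {K : Type*} [Field K] [Algebra k K] [IsTotallyReal K]
    (e : K ≃ₐ[k] AdjoinRoot (χ.map (algebraMap (𝓞 k) k))) (v : InfinitePlace k) :
    (χ.map (realEmb k v)).Splits := by
  refine Splits.of_splits_map Complex.ofRealHom (IsAlgClosed.splits _) fun z hz => ?_
  have hcomp : Complex.ofRealHom.comp (realEmb k v) =
      v.embedding.comp (algebraMap (𝓞 k) k) := RingHom.ext fun a => coe_realEmb v a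
  have hroot := isRoot_of_mem_roots hz
  rw [Polynomial.map_map, hcomp, ← Polynomial.map_map, IsRoot, eval_map] at hroot
  set φ : K →+* ℂ := (AdjoinRoot.lift v.embedding z hroot).comp e.toRingEquiv.toRingHom
  have hφ : φ (e.symm (AdjoinRoot.root _)) = z := by
    change AdjoinRoot.lift v.embedding z hroot (e (e.symm (AdjoinRoot.root _))) = z
    rw [AlgEquiv.apply_symm_apply, AdjoinRoot.lift_root]
  have hreal := ComplexEmbedding.IsReal.coe_embedding_apply
    (IsTotallyReal.complexEmbedding_isReal φ) (e.symm (AdjoinRoot.root _))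
  exact ⟨_, hreal.trans hφ⟩

/-- By Gauss's lemma χ stays irreducible over k, hence is separable in characteristic 0, and
separability survives extension to ℝ. -/
theorem map_realEmb_roots_nodup [NumberField k] {χ : (𝓞 k)[X]} (hm : χ.Monic)
    (hirr : Irreducible χ) (v : InfinitePlace k) : (χ.map (realEmb k v)).roots.Nodup := by
  have h := (hm.irreducible_iff_irreducible_map_fraction_map (K := k)).1 hirr
  have hsep := h.separable.map
    (f := InfinitePlace.embedding_of_isReal (IsTotallyReal.isReal v))
  rw [Polynomial.map_map] at hsep
  exact nodup_roots hsep

end NumberField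

end ArchVolume

theorem proposition5p2 {k : Type*} [Field k] [NumberField k] [IsTotallyReal k] {n : ℕ}
    (χ : (𝓞 k)[X]) (hmonic : χ.Monic) (hirr : Irreducible χ) (hdeg : χ.natDegree = n)
    {K : Type*} [Field K] [Algebra k K] [IsTotallyReal K]
    (e : K ≃ₐ[k] AdjoinRoot (χ.map (algebraMap (𝓞 k) k)))
    (x₀ : ArchVolume.CharpolyFiber n χ) :
    (∀ (v : InfinitePlace k) (T : ℝ), ArchVolume.localVolume x₀ v T < ∞) ∧
    Tendsto (fun T : ℝ =>
        (∏ v : InfinitePlace k, (ArchVolume.localVolume x₀ v T).toReal) /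
          ((ArchVolume.unitBallVolume n * Real.pi ^ ((n : ℝ) * (n + 1) / 4) /
              (∏ i ∈ Finset.Icc 1 n, Real.Gamma ((i : ℝ) / 2)) *
                T ^ (n * (n - 1) / 2)) ^ Module.finrank ℚ k *
            ∏ v : InfinitePlace k, v (χ.map (algebraMap (𝓞 k) k)).discr ^ (-(1 / 2) : ℝ)))
      atTop (𝓝 1) := by
  have hs := ArchVolume.map_realEmb_splits e
  have hn := ArchVolume.map_realEmb_roots_nodup hmonic hirr
  refine ⟨fun v T => ArchVolume.canMeasure_normBall_lt_top _ (hs v) (hn v) T, ?_⟩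
  have hpos : 0 < χ.natDegree := Nat.pos_of_ne_zero fun h =>
    hirr.not_isUnit (by rw [hmonic.natDegree_eq_zero.1 h]; exact isUnit_one)
  -- All archimedean places are real, so the degree counts them; this turns the product of equal
  -- local factors into a power.
  have hcard : Module.finrank ℚ k = (Finset.univ : Finset (InfinitePlace k)).card := by
    rw [IsTotallyReal.finrank, Finset.card_univ,
      InfinitePlace.card_eq_nrRealPlaces_add_nrComplexPlaces,
      IsTotallyReal.nrComplexPlaces_eq_zero, add_zero]
  have hdisc : ∀ v : InfinitePlace k, |(χ.map (ArchVolume.realEmb k v)).discr| =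
      v (χ.map (algebraMap (𝓞 k) k)).discr := fun v => by
    rw [ArchVolume.map_discr_of_monic _ hmonic hpos, ArchVolume.map_discr_of_monic _ hmonic hpos, ArchVolume.abs_realEmb]
  have h := tendsto_finsetProd Finset.univ fun (v : InfinitePlace k) _ =>
    ArchVolume.tendsto_canMeasure_normBall (x₀.baseChange (ArchVolume.realEmb k v)) (hmonic.map _) (hs v) (hn v)
      (by rwa [hmonic.natDegree_map])
  simp only [Finset.prod_const_one, Finset.prod_div_distrib, Finset.prod_mul_distrib,
    Finset.prod_const, ← hcard, hdisc] at h
  simpa only [mul_pow, div_pow, ArchVolume.localVolume] using h
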